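/- Let $D<0$ be an integer with $D\equiv 0$ or $1 \pmod 4$. Let $C(D)$ be the class group of discriminant $D$: its elements are the classes, under substitutions from $SL_2(\mathbb{Z})$, of primitive positive definite integral binary quadratic forms $ax^2+bxy+cy^2$ with $b^2-4ac=D$, and its operation is (Dirichlet) composition of forms. Let $r$ be an odd positive integer with prime factorization $r=\prod_{i=1}^k p_i^{e_i}$, and put $$\varphi_D(r)=\prod_{i=1}^k p_i^{e_i-1}\left(p_i-\left(\frac{D}{p_i}\right)\right),$$ where $\left(\frac{D}{p}\right)$ is the Kronecker symbol. Let $f\in C(Dr^2)$ be derived from $g\in C(D)$, i.e. for some forms representing these classes, denoted by the same letters, there is an integral $2\times 2$ matrix $A$ with $\det A=r$ and $f(x,y)=g(A\cdot(x,y)^T)$. If $a$ is the order of $g$ in $C(D)$, then the order of $f$ in $C(Dr^2)$ divides $a\cdot\varphi_D(r)$. -/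

import Mathlib

open scoped MatrixGroups

namespace BQF

/-- `D` is a negative discriminant: `D < 0` and `D ≡ 0, 1 (mod 4)`. -/
class NegDisc (D : ℤ) : Prop where
  neg : D < 0
  mod_four : D % 4 = 0 ∨ D % 4 = 1

instance NegDisc.mul_sq (D : ℤ) [h : NegDisc D] (r : ℕ) [NeZero r] :
    NegDisc (D * (r : ℤ) ^ 2) where
  neg := mul_neg_of_neg_of_pos h.neg (by have := NeZero.ne r; positivity)
  mod_four := by
    have h1 := h.mod_four
    have h2 : ((r : ℤ) ^ 2) % 4 = 0 ∨ ((r : ℤ) ^ 2) % 4 = 1 := by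
      rcases Int.even_or_odd' (r : ℤ) with ⟨k, hk | hk⟩ <;> rw [hk]
      · left; ring_nf; omega
      · right; ring_nf; omega
    rw [Int.mul_emod]
    rcases h1 with h1 | h1 <;> rcases h2 with h2 | h2 <;> simp [h1, h2]

/-- A primitive integral binary quadratic form `a x² + b x y + c y²` of discriminant `D`
with `a > 0`. For `D < 0`, the condition `a > 0` says that the form is positive definite. -/
@[ext]
structure Form (D : ℤ) where
  a : ℤ
  b : ℤ
  c : ℤ
  disc : b ^ 2 - 4 * a * c = D
  primitive : Int.gcd (Int.gcd a b) c = 1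
  pos : 0 < a

namespace Form

variable {D : ℤ}

/-- The value `f(x, y)`. -/
def eval (f : Form D) (x y : ℤ) : ℤ := f.a * x ^ 2 + f.b * x * y + f.c * y ^ 2

/-- `f ∼ g`: there is `A ∈ SL₂(ℤ)` with `f(x, y) = g(A (x, y)ᵀ)`. -/
def Equiv (f g : Form D) : Prop :=
  ∃ A : SL(2, ℤ), ∀ x y : ℤ, f.eval x y = g.eval (A 0 0 * x + A 0 1 * y) (A 1 0 * x + A 1 1 * y)

/-- `f`, of discriminant `D'`, equals `g(A (x, y)ᵀ)` for an integral matrix `A` of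
determinant `r`. -/
def IsDerived {D' : ℤ} (r : ℤ) (f : Form D') (g : Form D) : Prop :=
  ∃ A : Matrix (Fin 2) (Fin 2) ℤ, A.det = r ∧
    ∀ x y : ℤ, f.eval x y = g.eval (A 0 0 * x + A 0 1 * y) (A 1 0 * x + A 1 1 * y)

/-- `h` is a Dirichlet composition of `f = (a₁, b₁, c₁)` and `g = (a₂, b₂, c₂)`:
`gcd(a₁, a₂, (b₁ + b₂)/2) = 1` and `h = (a₁ a₂, B, (B² - D) / (4 a₁ a₂))` with
`B ≡ b₁ (mod 2 a₁)` and `B ≡ b₂ (mod 2 a₂)`. The last coefficient of `h`, and the congruence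
`B² ≡ D (mod 4 a₁ a₂)`, come from `h` having discriminant `D`. -/
def IsDirichletComposition (f g h : Form D) : Prop :=
  Int.gcd (Int.gcd f.a g.a) ((f.b + g.b) / 2) = 1 ∧
    h.a = f.a * g.a ∧ h.b ≡ f.b [ZMOD 2 * f.a] ∧ h.b ≡ g.b [ZMOD 2 * g.a]

/-! ### Equivalence in coordinates -/

theorem equiv_iff (f g : Form D) : f.Equiv g ↔ ∃ p q r s : ℤ, p * s - q * r = 1 ∧
    f.a = g.eval p r ∧ f.b = 2 * g.a * p * q + g.b * (p * s + q * r) + 2 * g.c * r * s ∧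
    f.c = g.eval q s := by
  constructor
  · rintro ⟨A, hA⟩
    refine ⟨A 0 0, A 0 1, A 1 0, A 1 1, ?_, ?_, ?_, ?_⟩
    · have := A.det_coe; rwa [Matrix.det_fin_two] at this
    · have := hA 1 0; simp [eval] at this ⊢; linarith
    · have h1 := hA 1 1
      have h2 := hA 1 0
      have h3 := hA 0 1
      simp only [eval] at h1 h2 h3 ⊢
      linear_combination h1 - h2 - h3
    · have := hA 0 1; simp [eval] at this ⊢; linarith
  · rintro ⟨p, q, r, s, h, ha, hb, hc⟩
    refine ⟨⟨!![p, q; r, s], by rw [Matrix.det_fin_two]; simpa using h⟩, fun x y => ?_⟩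
    simp only [eval] at ha hc ⊢
    simp only [Matrix.of_apply, Matrix.cons_val', Matrix.cons_val_zero, Matrix.cons_val_one,
      Matrix.cons_val_fin_one]
    rw [ha, hb, hc]; ring

theorem equiv_refl (f : Form D) : f.Equiv f := ⟨1, fun x y => by simp⟩

theorem equiv_symm {f g : Form D} (h : f.Equiv g) : g.Equiv f := by
  obtain ⟨A, hA⟩ := h
  refine ⟨A⁻¹, fun x y => ?_⟩
  have hd : A 0 0 * A 1 1 - A 0 1 * A 1 0 = 1 := by
    have := A.det_coe; rwa [Matrix.det_fin_two] at this
  rw [hA]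
  simp only [Matrix.SpecialLinearGroup.SL2_inv_expl A, Matrix.cons_val',
    Matrix.cons_val_zero, Matrix.cons_val_one, Matrix.cons_val_fin_one]
  congr 1
  · linear_combination (-x) * hd
  · linear_combination (-y) * hd

theorem equiv_trans {f g h : Form D} (h₁ : f.Equiv g) (h₂ : g.Equiv h) : f.Equiv h := by
  obtain ⟨A, hA⟩ := h₁
  obtain ⟨B, hB⟩ := h₂
  refine ⟨B * A, fun x y => ?_⟩
  rw [hA, hB]
  simp only [Matrix.SpecialLinearGroup.coe_mul, Matrix.mul_apply, Fin.sum_univ_two]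
  congr 1 <;> ring

instance setoid (D : ℤ) : Setoid (Form D) := ⟨Equiv, equiv_refl, equiv_symm, equiv_trans⟩

/-! ### The lattice of a form, used only to verify that composition is well defined -/

section Lattice

/-- A square root of the negative number `D` in the upper half plane. -/
noncomputable def rt (D : ℤ) : ℂ := (Real.sqrt (-D) : ℝ) * Complex.I

theorem rt_sq [h : NegDisc D] : rt D ^ 2 = D := by
  have h0 : (0 : ℝ) ≤ -D := by
    have : (D : ℝ) < 0 := by exact_mod_cast h.neg
    linarith
  rw [rt, mul_pow, Complex.I_sq, ← Complex.ofReal_pow, Real.sq_sqrt h0]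
  push_cast; ring

theorem rt_indep [h : NegDisc D] {x y z w : ℤ} (e : (x : ℂ) + y * rt D = z + w * rt D) :
    x = z ∧ y = w := by
  have h0 : Real.sqrt (-D) ≠ 0 := by
    have : (D : ℝ) < 0 := by exact_mod_cast h.neg
    exact (Real.sqrt_pos.2 (by linarith)).ne'
  have hre := congrArg Complex.re e
  have him := congrArg Complex.im e
  simp [rt] at hre him
  refine ⟨by exact_mod_cast hre, ?_⟩
  rcases him with him | him
  · exact_mod_cast him
  · exact absurd him h0

theorem rt_ne [h : NegDisc D] : rt D ≠ 0 := by
  intro e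
  have := rt_sq (D := D)
  rw [e] at this
  have h2 : (D : ℂ) = 0 := by rw [← this]; simp
  have := h.neg
  have h3 : D = 0 := by exact_mod_cast h2
  omega

/-- The lattice `ℤ 2a + ℤ (-b + √D)` of the form `(a, b, c)`. -/
noncomputable def lat (f : Form D) : Submodule ℤ ℂ :=
  Submodule.span ℤ {(2 * f.a : ℂ), -f.b + rt D}

/-- Two lattices in `ℂ` are homothetic. -/
def Homothetic (L M : Submodule ℤ ℂ) : Prop :=
  ∃ u v : ℂ, u ≠ 0 ∧ v ≠ 0 ∧ Submodule.span ℤ {u} * L = Submodule.span ℤ {v} * M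

theorem Homothetic.of_eq {L M : Submodule ℤ ℂ} (h : L = M) : Homothetic L M :=
  ⟨1, 1, one_ne_zero, one_ne_zero, by rw [h]⟩

theorem Homothetic.symm {L M : Submodule ℤ ℂ} (h : Homothetic L M) : Homothetic M L := by
  obtain ⟨u, v, hu, hv, e⟩ := h
  exact ⟨v, u, hv, hu, e.symm⟩

theorem span_singleton_mul_mul (u v : ℂ) (L M : Submodule ℤ ℂ) :
    Submodule.span ℤ {u * v} * (L * M) =
      (Submodule.span ℤ {u} * L) * (Submodule.span ℤ {v} * M) := by
  have : Submodule.span ℤ {u * v} = Submodule.span ℤ {u} * Submodule.span ℤ {v} := by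
    rw [Submodule.span_mul_span, Set.singleton_mul_singleton]
  rw [this, mul_mul_mul_comm]

theorem span_singleton_mul' (u v : ℂ) (L : Submodule ℤ ℂ) :
    Submodule.span ℤ {u * v} * L = Submodule.span ℤ {u} * (Submodule.span ℤ {v} * L) := by
  have : Submodule.span ℤ {u * v} = Submodule.span ℤ {u} * Submodule.span ℤ {v} := by
    rw [Submodule.span_mul_span, Set.singleton_mul_singleton]
  rw [this, mul_assoc]

theorem Homothetic.trans {L M N : Submodule ℤ ℂ} (h : Homothetic L M) (h' : Homothetic M N) :
    Homothetic L N := by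
  obtain ⟨u, v, hu, hv, e⟩ := h
  obtain ⟨u', v', hu', hv', e'⟩ := h'
  refine ⟨u' * u, v * v', mul_ne_zero hu' hu, mul_ne_zero hv hv', ?_⟩
  rw [span_singleton_mul', e, ← span_singleton_mul', mul_comm u' v, span_singleton_mul', e',
    ← span_singleton_mul']

theorem Homothetic.mul {L M L' M' : Submodule ℤ ℂ} (h : Homothetic L M)
    (h' : Homothetic L' M') : Homothetic (L * L') (M * M') := by
  obtain ⟨u, v, hu, hv, e⟩ := h
  obtain ⟨u', v', hu', hv', e'⟩ := h'
  refine ⟨u * u', v * v', mul_ne_zero hu hu', mul_ne_zero hv hv', ?_⟩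
  rw [span_singleton_mul_mul, span_singleton_mul_mul, e, e']

theorem mul_span_pair (u z w : ℂ) :
    Submodule.span ℤ {u} * Submodule.span ℤ {z, w} = Submodule.span ℤ {u * z, u * w} := by
  rw [Submodule.span_mul_span, Set.singleton_mul, Set.image_pair]

theorem span_pair_le {z w : ℂ} {L : Submodule ℤ ℂ} (hz : z ∈ L) (hw : w ∈ L) :
    Submodule.span ℤ {z, w} ≤ L := by
  rw [Submodule.span_le]
  rintro t (rfl | rfl)
  · exact hz
  · exact hw

theorem mem_pair {z w t : ℂ} (x y : ℤ) (h : x * z + y * w = t) :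
    t ∈ Submodule.span ℤ {z, w} := by
  rw [Submodule.mem_span_pair]
  exact ⟨x, y, by simpa using h⟩

theorem cast_disc (f : Form D) : (f.b : ℂ) ^ 2 - 4 * f.a * f.c = D := by
  exact_mod_cast congrArg (Int.cast : ℤ → ℂ) f.disc

theorem lat_eq_of_modEq (f : Form D) {B : ℤ} (h : B ≡ f.b [ZMOD 2 * f.a]) :
    f.lat = Submodule.span ℤ {(2 * f.a : ℂ), -B + rt D} := by
  obtain ⟨k, hk⟩ := h.dvd
  have hk' : (f.b : ℂ) - B = 2 * f.a * k := by exact_mod_cast congrArg (Int.cast : ℤ → ℂ) hk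
  rw [lat]
  apply le_antisymm
  · exact span_pair_le (mem_pair 1 0 (by push_cast; ring))
      (mem_pair (-k) 1 (by push_cast; linear_combination hk'))
  · exact span_pair_le (mem_pair 1 0 (by push_cast; ring))
      (mem_pair k 1 (by push_cast; linear_combination -hk'))

variable [hD : NegDisc D]

theorem Equiv.homothetic {f g : Form D} (h : f.Equiv g) : Homothetic f.lat g.lat := by
  obtain ⟨p, q, r, s, hd, ha, hb, hc⟩ := (equiv_iff f g).1 h
  have hδ := rt_sq (D := D)
  have hg := cast_disc g
  have ha' : (f.a : ℂ) = g.a * p ^ 2 + g.b * p * r + g.c * r ^ 2 := by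
    rw [ha, eval]; push_cast; ring
  have hb' : (f.b : ℂ) = 2 * g.a * p * q + g.b * (p * s + q * r) + 2 * g.c * r * s := by
    rw [hb]; push_cast; ring
  have hd' : (p : ℂ) * s - q * r = 1 := by exact_mod_cast congrArg (Int.cast : ℤ → ℂ) hd
  have hfa : (f.a : ℂ) ≠ 0 := by exact_mod_cast f.pos.ne'
  -- the two generators of the first lattice, in terms of those of the second
  have e1 : ((2 * g.a * p - r * (-g.b + rt D)) : ℂ) * (2 * f.a) =
      (2 * f.a) * (p * (2 * g.a) - r * (-g.b + rt D)) := by ring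
  have e2 : ((2 * g.a * p - r * (-g.b + rt D)) : ℂ) * (-f.b + rt D) =
      (2 * f.a) * (s * (-g.b + rt D) - q * (2 * g.a)) := by
    rw [ha', hb']
    linear_combination (-(r : ℂ)) * hδ + (-(2 * g.a * p + r * g.b) * rt D + r * D) * hd' +
      (r * (p * s - q * r) : ℂ) * hg
  refine ⟨2 * g.a * p - r * (-g.b + rt D), 2 * f.a, ?_, by simpa using hfa, ?_⟩
  · intro h0
    rw [h0, zero_mul] at e1 e2
    have e1' := (mul_eq_zero.1 e1.symm).resolve_left (by simpa using hfa)
    have e2' := (mul_eq_zero.1 e2.symm).resolve_left (by simpa using hfa)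
    have : (-g.b + rt D : ℂ) = 0 := by
      linear_combination (q : ℂ) * e1' + (p : ℂ) * e2' - (-g.b + rt D) * hd'
    have := (rt_indep (D := D) (x := -g.b) (y := 1) (z := 0) (w := 0)
      (by push_cast; linear_combination this)).2
    omega
  · rw [lat, lat, mul_span_pair, mul_span_pair, e1, e2]
    apply le_antisymm
    · exact span_pair_le (mem_pair p (-r) (by push_cast; ring))
        (mem_pair (-q) s (by push_cast; ring))
    · refine span_pair_le (mem_pair s r ?_) (mem_pair q p ?_)
      · linear_combination (2 * f.a * (2 * g.a) : ℂ) * hd'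
      · linear_combination (2 * f.a * (-g.b + rt D) : ℂ) * hd'

theorem equiv_of_homothetic {f g : Form D} (h : Homothetic f.lat g.lat) : f.Equiv g := by
  obtain ⟨u, v, hu, hv, e⟩ := h
  rw [lat, lat, mul_span_pair, mul_span_pair] at e
  have hδ := rt_sq (D := D)
  have m1 : u * (2 * f.a) ∈ Submodule.span ℤ {v * (2 * g.a), v * (-g.b + rt D)} := by
    rw [← e]; exact Submodule.subset_span (by simp)
  have m2 : u * (-f.b + rt D) ∈ Submodule.span ℤ {v * (2 * g.a), v * (-g.b + rt D)} := by
    rw [← e]; exact Submodule.subset_span (by simp)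
  have m3 : v * (2 * g.a) ∈ Submodule.span ℤ {u * (2 * f.a), u * (-f.b + rt D)} := by
    rw [e]; exact Submodule.subset_span (by simp)
  have m4 : v * (-g.b + rt D) ∈ Submodule.span ℤ {u * (2 * f.a), u * (-f.b + rt D)} := by
    rw [e]; exact Submodule.subset_span (by simp)
  rw [Submodule.mem_span_pair] at m1 m2 m3 m4
  obtain ⟨x, y, h1⟩ := m1
  obtain ⟨z, w, h2⟩ := m2
  obtain ⟨x', y', h3⟩ := m3
  obtain ⟨z', w', h4⟩ := m4
  simp only [zsmul_eq_mul] at h1 h2 h3 h4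
  have hga : g.a ≠ 0 := g.pos.ne'
  have hfa : f.a ≠ 0 := f.pos.ne'
  -- the two coordinate matrices are inverse to each other
  have k1 : (2 * g.a : ℂ) = (x' * x + y' * z) * (2 * g.a) + (x' * y + y' * w) * (-g.b + rt D) := by
    apply mul_left_cancel₀ hv
    linear_combination -h3 - (x' : ℂ) * h1 - (y' : ℂ) * h2
  have k2 : (-g.b + rt D : ℂ) =
      (z' * x + w' * z) * (2 * g.a) + (z' * y + w' * w) * (-g.b + rt D) := by
    apply mul_left_cancel₀ hv
    linear_combination -h4 - (z' : ℂ) * h1 - (w' : ℂ) * h2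
  have k1' := rt_indep (D := D) (x := 2 * g.a) (y := 0)
    (z := (x' * x + y' * z) * (2 * g.a) - (x' * y + y' * w) * g.b) (w := x' * y + y' * w)
    (by push_cast; linear_combination k1)
  have k2' := rt_indep (D := D) (x := -g.b) (y := 1)
    (z := (z' * x + w' * z) * (2 * g.a) - (z' * y + w' * w) * g.b) (w := z' * y + w' * w)
    (by push_cast; linear_combination k2)
  have i1 : x' * x + y' * z = 1 := by
    apply mul_right_cancel₀ (mul_ne_zero two_ne_zero hga)
    linear_combination -k1'.1 - g.b * k1'.2
  have i2 : z' * x + w' * z = 0 := by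
    apply mul_right_cancel₀ (mul_ne_zero two_ne_zero hga)
    linear_combination -k2'.1 - g.b * k2'.2
  have hdet : (x * w - y * z) * (x' * w' - y' * z') = 1 := by
    linear_combination (z' * y + w' * w) * i1 - k2'.2 - (x' * y + y' * w) * i2
  have hdet' : x * w - y * z = 1 ∨ x * w - y * z = -1 := Int.eq_one_or_neg_one_of_mul_eq_one hdet
  -- comparison of coordinates
  have k3 : (-f.b + rt D : ℂ) * (x * (2 * g.a) + y * (-g.b + rt D)) =
      2 * f.a * (z * (2 * g.a) + w * (-g.b + rt D)) := by
    apply mul_left_cancel₀ (mul_ne_zero hu hv)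
    linear_combination (u * (-f.b + rt D)) * h1 - (u * (2 * f.a)) * h2
  obtain ⟨k4, k5⟩ := rt_indep (D := D) (x := -f.b * (2 * g.a * x - g.b * y) + y * D)
    (y := 2 * g.a * x - g.b * y - f.b * y) (z := 2 * f.a * (2 * g.a * z - g.b * w))
    (w := 2 * f.a * w) (by push_cast; linear_combination k3 - (y : ℂ) * hδ)
  have hgd := g.disc
  have hfd := f.disc
  have k6 : f.a * (x * w - y * z) = g.eval x (-y) := by
    apply mul_left_cancel₀ (mul_ne_zero four_ne_zero hga)
    rw [eval]
    linear_combination (-2 * g.a * x + g.b * y) * k5 + y * k4 + y ^ 2 * hgd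
  have k7 : 0 ≤ 4 * g.a * g.eval x (-y) := by
    have : 4 * g.a * g.eval x (-y) = (2 * g.a * x - g.b * y) ^ 2 + (-D) * y ^ 2 := by
      rw [eval]; linear_combination - y ^ 2 * hgd
    rw [this]
    have := hD.neg
    have : 0 ≤ -D := by omega
    positivity
  have hd1 : x * w - y * z = 1 := by
    rcases hdet' with h | h
    · exact h
    · rw [← k6, h] at k7
      have := f.pos
      have := g.pos
      nlinarith [mul_pos f.pos g.pos]
  rw [hd1, mul_one] at k6
  have k8 : f.b = 2 * g.a * x * (-z) + g.b * (x * w + (-z) * (-y)) + 2 * g.c * (-y) * w := by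
    rw [eval] at k6
    apply mul_left_cancel₀ (mul_ne_zero two_ne_zero hga)
    linear_combination (-w) * k4 + (2 * g.a * z - g.b * w) * k5 - 2 * g.a * f.b * hd1
      - y * w * hgd
  refine (equiv_iff f g).2 ⟨x, -z, -y, w, by linear_combination hd1, k6, k8, ?_⟩
  apply mul_left_cancel₀ (mul_ne_zero four_ne_zero hfa)
  have k9 : 4 * g.eval x (-y) * g.eval (-z) w =
      (2 * g.a * x * (-z) + g.b * (x * w + (-z) * (-y)) + 2 * g.c * (-y) * w) ^ 2 - D := by
    simp only [eval]
    linear_combination (-(x * w - y * z) ^ 2) * hgd - D * (x * w - y * z + 1) * hd1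
  rw [k8] at hfd
  rw [← k6] at k9
  linear_combination -k9 - hfd

theorem IsDirichletComposition.lat_mul {f g h : Form D} (H : IsDirichletComposition f g h) :
    Homothetic (f.lat * g.lat) h.lat := by
  obtain ⟨hgcd, ha, hf, hg⟩ := H
  have hδ := rt_sq (D := D)
  have hh := cast_disc h
  have ha' : (h.a : ℂ) = f.a * g.a := by exact_mod_cast congrArg (Int.cast : ℤ → ℂ) ha
  -- a Bezout relation
  obtain ⟨s, t, m, hbez⟩ : ∃ s t m : ℤ, s * f.a + t * g.a + m * h.b = 1 := by
    obtain ⟨k, hk⟩ := hf.dvd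
    obtain ⟨l, hl⟩ := hg.dvd
    have hmid : (f.b + g.b) / 2 = h.b + f.a * k + g.a * l := by
      rw [show f.b + g.b = 2 * (h.b + f.a * k + g.a * l) by linear_combination hk + hl]
      exact Int.mul_ediv_cancel_left _ two_ne_zero
    rw [hmid] at hgcd
    obtain ⟨s, t, hst⟩ : ∃ s t : ℤ, (Int.gcd f.a g.a : ℤ) = f.a * s + g.a * t :=
      ⟨_, _, Int.gcd_eq_gcd_ab f.a g.a⟩
    obtain ⟨m, n, hmn⟩ : ∃ m n : ℤ, (1 : ℤ) =
        (Int.gcd f.a g.a : ℤ) * m + (h.b + f.a * k + g.a * l) * n :=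
      ⟨_, _, by rw [← Int.gcd_eq_gcd_ab, hgcd, Nat.cast_one]⟩
    exact ⟨s * m + k * n, t * m + l * n, n, by linear_combination -hmn - m * hst⟩
  have hbez' : (s : ℂ) * f.a + t * g.a + m * h.b = 1 := by
    exact_mod_cast congrArg (Int.cast : ℤ → ℂ) hbez
  refine ⟨1, 2, one_ne_zero, two_ne_zero, ?_⟩
  rw [lat_eq_of_modEq f hf, lat_eq_of_modEq g hg, ← Submodule.one_eq_span, one_mul,
    lat, mul_span_pair]
  apply le_antisymm
  · rw [Submodule.span_mul_span, Submodule.span_le]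
    rintro z ⟨z₁, (rfl | rfl), z₂, (rfl | rfl), rfl⟩
    · exact mem_pair 1 0 (by push_cast; rw [ha']; ring)
    · exact mem_pair 0 f.a (by push_cast; ring)
    · exact mem_pair 0 g.a (by push_cast; ring)
    · exact mem_pair (-h.c) (-h.b) (by push_cast; linear_combination -hδ + hh)
  · have sm : ∀ x ∈ ({(2 * f.a : ℂ), -h.b + rt D} : Set ℂ),
        ∀ y ∈ ({(2 * g.a : ℂ), -h.b + rt D} : Set ℂ),
        x * y ∈ Submodule.span ℤ {(2 * f.a : ℂ), -h.b + rt D} *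
          Submodule.span ℤ {(2 * g.a : ℂ), -h.b + rt D} :=
      fun x hx y hy => Submodule.mul_mem_mul (Submodule.subset_span hx) (Submodule.subset_span hy)
    have s1 := sm (2 * f.a) (by simp) (2 * g.a) (by simp)
    have s2 := sm (2 * f.a) (by simp) (-h.b + rt D) (by simp)
    have s3 := sm (-h.b + rt D) (by simp) (2 * g.a) (by simp)
    have s4 := sm (-h.b + rt D) (by simp) (-h.b + rt D) (by simp)
    refine span_pair_le ?_ ?_
    · convert s1 using 1
      rw [ha']; ring
    · convert add_mem (add_mem (Submodule.smul_mem _ s s2) (Submodule.smul_mem _ t s3))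
        (add_mem (Submodule.smul_mem _ (-m) s4) (Submodule.smul_mem _ (-m * h.c) s1)) using 1
      simp only [zsmul_eq_mul]
      push_cast
      linear_combination (-2 * (-h.b + rt D : ℂ)) * hbez' + (m : ℂ) * hδ - (m : ℂ) * hh -
        4 * m * h.c * ha'

/-- Dirichlet composition is well defined on equivalence classes. -/
theorem IsDirichletComposition.equiv {f g h f' g' h' : Form D}
    (H : IsDirichletComposition f g h) (H' : IsDirichletComposition f' g' h')
    (hf : f.Equiv f') (hg : g.Equiv g') : h.Equiv h' :=
  equiv_of_homothetic
    ((H.lat_mul.symm.trans (hf.homothetic.mul hg.homothetic)).trans H'.lat_mul)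

end Lattice

/-! ### Existence of compositions -/

theorem b_emod (f : Form D) : f.b % 2 = D % 2 := by
  have h := f.disc
  have : D = f.b * f.b - 2 * (2 * (f.a * f.c)) := by linear_combination -h
  rcases Int.emod_two_eq_zero_or_one f.b with h0 | h0 <;>
  · have h1 := Int.mul_emod f.b f.b 2
    rw [h0] at h1
    omega

/-- The form `f(px + qy, rx + sy)` for `ps - qr = 1`. -/
theorem exists_subst [hD : NegDisc D] (f : Form D) {p q r s : ℤ} (h : p * s - q * r = 1) :
    ∃ g : Form D, g.Equiv f ∧ g.a = f.eval p r ∧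
      g.b = 2 * f.a * p * q + f.b * (p * s + q * r) + 2 * f.c * r * s := by
  have hd := f.disc
  have h0 : 0 ≤ 4 * f.a * f.eval p r := by
    have : 4 * f.a * f.eval p r = (2 * f.a * p + f.b * r) ^ 2 + (-D) * r ^ 2 := by
      rw [eval]; linear_combination - r ^ 2 * hd
    rw [this]
    have := hD.neg
    have : 0 ≤ -D := by omega
    positivity
  have hdisc : (2 * f.a * p * q + f.b * (p * s + q * r) + 2 * f.c * r * s) ^ 2
      - 4 * f.eval p r * f.eval q s = D := by
    simp only [eval]
    linear_combination (p * s - q * r) ^ 2 * hd + D * (p * s - q * r + 1) * h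
  refine ⟨⟨f.eval p r, 2 * f.a * p * q + f.b * (p * s + q * r) + 2 * f.c * r * s, f.eval q s,
    hdisc, ?_, ?_⟩, ?_, rfl, rfl⟩
  · -- the coefficients of `f` are integral combinations of the new ones
    set A := f.eval p r with hA
    set B := 2 * f.a * p * q + f.b * (p * s + q * r) + 2 * f.c * r * s with hB
    set C := f.eval q s with hC
    have ea : f.a = A * s ^ 2 - B * s * r + C * r ^ 2 := by
      simp only [hA, hB, hC, eval]
      linear_combination (-f.a * (p * s - q * r + 1)) * h
    have eb : f.b = -2 * A * s * q + B * (p * s + q * r) - 2 * C * p * r := by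
      simp only [hA, hB, hC, eval]
      linear_combination (-f.b * (p * s - q * r + 1)) * h
    have ec : f.c = A * q ^ 2 - B * q * p + C * p ^ 2 := by
      simp only [hA, hB, hC, eval]
      linear_combination (-f.c * (p * s - q * r + 1)) * h
    have dA : ((Int.gcd (Int.gcd A B) C : ℕ) : ℤ) ∣ A :=
      (Int.gcd_dvd_left ..).trans (Int.gcd_dvd_left ..)
    have dB : ((Int.gcd (Int.gcd A B) C : ℕ) : ℤ) ∣ B :=
      (Int.gcd_dvd_left ..).trans (Int.gcd_dvd_right ..)
    have dC : ((Int.gcd (Int.gcd A B) C : ℕ) : ℤ) ∣ C := Int.gcd_dvd_right ..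
    generalize Int.gcd (Int.gcd A B) C = d at *
    have da : (d : ℤ) ∣ f.a := by
      rw [ea]
      exact dvd_add (dvd_sub (dA.mul_right _) ((dB.mul_right _).mul_right _)) (dC.mul_right _)
    have db : (d : ℤ) ∣ f.b := by
      rw [eb]
      exact dvd_sub (dvd_add (((dA.mul_left _).mul_right _).mul_right _) (dB.mul_right _))
        (((dC.mul_left _).mul_right _).mul_right _)
    have dc : (d : ℤ) ∣ f.c := by
      rw [ec]
      exact dvd_add (dvd_sub (dA.mul_right _) ((dB.mul_right _).mul_right _)) (dC.mul_right _)
    have := Int.dvd_coe_gcd (Int.dvd_coe_gcd da db) dc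
    rw [f.primitive] at this
    exact Nat.dvd_one.1 (by exact_mod_cast this)
  · have hne : f.eval p r ≠ 0 := by
      intro e
      rw [e] at hdisc
      have := hD.neg
      nlinarith [sq_nonneg (2 * f.a * p * q + f.b * (p * s + q * r) + 2 * f.c * r * s)]
    have := f.pos
    have : 0 ≤ f.eval p r := by
      by_contra hc
      push Not at hc
      nlinarith
    omega
  · exact (equiv_iff _ _).2 ⟨p, q, r, s, h, rfl, rfl, rfl⟩

theorem isCoprime_of_primes {x y : ℤ}
    (h : ∀ l : ℕ, l.Prime → (l : ℤ) ∣ x → ¬ (l : ℤ) ∣ y) : IsCoprime x y := by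
  rw [Int.isCoprime_iff_gcd_eq_one]
  apply Nat.coprime_of_dvd
  intro l hl hx hy
  exact h l hl (Int.natCast_dvd.2 hx) (Int.natCast_dvd.2 hy)

theorem dvd_trans_eq {l x y : ℤ} (h : l ∣ x) (e : x = y) : l ∣ y := e ▸ h

theorem not_dvd_all (f : Form D) {l : ℕ} (hl : l.Prime) (ha : (l : ℤ) ∣ f.a)
    (hb : (l : ℤ) ∣ f.b) (hc : (l : ℤ) ∣ f.c) : False := by
  have := Int.dvd_coe_gcd (Int.dvd_coe_gcd ha hb) hc
  rw [f.primitive] at this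
  exact hl.one_lt.ne' (Nat.dvd_one.1 (by exact_mod_cast this))

/-- A primitive form properly represents a number coprime to a given `N ≠ 0`. -/
theorem exists_coprime_value (f : Form D) {N : ℕ} (hN : N ≠ 0) :
    ∃ p r : ℤ, IsCoprime p r ∧ IsCoprime (f.eval p r) N := by
  classical
  set Q : Finset ℕ := N.primeFactors.filter fun l : ℕ => (l : ℤ) ∣ f.a ∧ ¬ (l : ℤ) ∣ f.c with hQ
  set R : Finset ℕ := N.primeFactors.filter fun l : ℕ => ¬ (l : ℤ) ∣ f.a with hR
  have key : ∀ (S : Finset ℕ), S ⊆ N.primeFactors → ∀ l : ℕ, l.Prime →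
      ((l : ℤ) ∣ ((∏ i ∈ S, i : ℕ) : ℤ) ↔ l ∈ S) := by
    intro S hS l hl
    rw [Int.natCast_dvd_natCast, hl.prime.dvd_finsetProd_iff]
    constructor
    · rintro ⟨i, hi, hd⟩
      rwa [(Nat.prime_dvd_prime_iff_eq hl (Nat.prime_of_mem_primeFactors (hS hi))).1 hd]
    · exact fun h => ⟨l, h, dvd_rfl⟩
  have kQ := key Q (Finset.filter_subset _ _)
  have kR := key R (Finset.filter_subset _ _)
  refine ⟨((∏ i ∈ Q, i : ℕ) : ℤ), ((∏ i ∈ R, i : ℕ) : ℤ), ?_, ?_⟩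
  · apply isCoprime_of_primes
    intro l hl h1 h2
    rw [kQ l hl, hQ, Finset.mem_filter] at h1
    rw [kR l hl, hR, Finset.mem_filter] at h2
    exact h2.2 h1.2.1
  · apply isCoprime_of_primes
    intro l hl h1 h2
    have hlN : l ∈ N.primeFactors := Nat.mem_primeFactors.2 ⟨hl, by exact_mod_cast h2, hN⟩
    have eQ := kQ l hl
    have eR := kR l hl
    rw [hQ, Finset.mem_filter] at eQ
    rw [hR, Finset.mem_filter] at eR
    generalize ((∏ i ∈ Q, i : ℕ) : ℤ) = p at *
    generalize ((∏ i ∈ R, i : ℕ) : ℤ) = r at *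
    have hp : Prime (l : ℤ) := Nat.prime_iff_prime_int.1 hl
    rw [eval] at h1
    by_cases ha : (l : ℤ) ∣ f.a
    · have nr : ¬ (l : ℤ) ∣ r := fun h => (eR.1 h).2 ha
      by_cases hc : (l : ℤ) ∣ f.c
      · have np : ¬ (l : ℤ) ∣ p := fun h => (eQ.1 h).2.2 hc
        have h3 : (l : ℤ) ∣ f.b * p * r := by
          have := dvd_sub (dvd_sub h1 (ha.mul_right (p ^ 2))) (hc.mul_right (r ^ 2))
          refine dvd_trans_eq this ?_
          ring
        rcases hp.dvd_or_dvd h3 with h3 | h3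
        · rcases hp.dvd_or_dvd h3 with h3 | h3
          · exact f.not_dvd_all hl ha h3 hc
          · exact np h3
        · exact nr h3
      · have dp : (l : ℤ) ∣ p := eQ.2 ⟨hlN, ha, hc⟩
        have h3 : (l : ℤ) ∣ f.c * r ^ 2 := by
          have := dvd_sub h1 (dp.mul_right (f.a * p + f.b * r))
          refine dvd_trans_eq this ?_
          ring
        rcases hp.dvd_or_dvd h3 with h3 | h3
        · exact hc h3
        · exact nr (hp.dvd_of_dvd_pow h3)
    · have dr : (l : ℤ) ∣ r := eR.2 ⟨hlN, ha⟩
      have np : ¬ (l : ℤ) ∣ p := fun h => ha (eQ.1 h).2.1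
      have h3 : (l : ℤ) ∣ f.a * p ^ 2 := by
        have := dvd_sub h1 (dr.mul_right (f.b * p + f.c * r))
        refine dvd_trans_eq this ?_
        ring
      rcases hp.dvd_or_dvd h3 with h3 | h3
      · exact ha h3
      · exact np (hp.dvd_of_dvd_pow h3)

/-- Two forms with coprime leading coefficients have a Dirichlet composition. -/
theorem exists_composition_of_isCoprime (f g : Form D) (h : IsCoprime f.a g.a) :
    ∃ k : Form D, IsDirichletComposition f g k := by
  obtain ⟨u, v, huv⟩ := h
  obtain ⟨m, hm⟩ : ∃ m, g.b - f.b = 2 * m := by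
    have h1 := f.b_emod
    have h2 := g.b_emod
    exact ⟨(g.b - f.b) / 2, by omega⟩
  have hf := f.disc
  have hg := g.disc
  obtain ⟨B, hB⟩ : ∃ B, B = f.b + 2 * f.a * (u * m) := ⟨_, rfl⟩
  have hB' : B = g.b - 2 * g.a * (v * m) := by
    linear_combination hB - hm + 2 * m * huv
  obtain ⟨X, hX⟩ : ∃ X, X = f.c + u * m * f.b + f.a * (u * m) ^ 2 := ⟨_, rfl⟩
  obtain ⟨Y, hY⟩ : ∃ Y, Y = g.c - v * m * g.b + g.a * (v * m) ^ 2 := ⟨_, rfl⟩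
  have hBX : B ^ 2 - D = 4 * f.a * X := by rw [hB, hX]; linear_combination hf
  have hBY : B ^ 2 - D = 4 * g.a * Y := by rw [hB', hY]; linear_combination hg
  have hXY : f.a * X = g.a * Y := by linarith
  have hXC : X = g.a * (u * Y + v * X) := by linear_combination (-X) * huv + u * hXY
  have hYC : Y = f.a * (u * Y + v * X) := by linear_combination (-Y) * huv - v * hXY
  generalize u * Y + v * X = C at hXC hYC
  have hcop : Int.gcd f.a g.a = 1 := Int.isCoprime_iff_gcd_eq_one.1 ⟨u, v, huv⟩
  have hprim : Int.gcd (Int.gcd (f.a * g.a) B) C = 1 := by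
    rw [← Int.isCoprime_iff_gcd_eq_one]
    apply isCoprime_of_primes
    intro l hl h1 hC
    have hA : (l : ℤ) ∣ f.a * g.a := h1.trans (Int.gcd_dvd_left ..)
    have hlB : (l : ℤ) ∣ B := h1.trans (Int.gcd_dvd_right ..)
    rcases (Nat.prime_iff_prime_int.1 hl).dvd_or_dvd hA with ha | ha
    · have db : (l : ℤ) ∣ f.b := by
        have := dvd_sub hlB (ha.mul_right (2 * (u * m)))
        refine dvd_trans_eq this ?_
        rw [hB]; ring
      refine f.not_dvd_all hl ha db ?_
      have := dvd_sub (dvd_sub (hC.mul_left g.a) (db.mul_left (u * m)))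
        (ha.mul_right ((u * m) ^ 2))
      refine dvd_trans_eq this ?_
      rw [← hXC, hX]; ring
    · have db : (l : ℤ) ∣ g.b := by
        have := dvd_add hlB (ha.mul_right (2 * (v * m)))
        refine dvd_trans_eq this ?_
        rw [hB']; ring
      refine g.not_dvd_all hl ha db ?_
      have := dvd_sub (dvd_add (hC.mul_left f.a) (db.mul_left (v * m)))
        (ha.mul_right ((v * m) ^ 2))
      refine dvd_trans_eq this ?_
      rw [← hYC, hY]; ring
  refine ⟨⟨f.a * g.a, B, C, ?_, hprim, mul_pos f.pos g.pos⟩, ?_, rfl, ?_, ?_⟩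
  · linear_combination hBX + 4 * f.a * hXC
  · rw [hcop]; simp
  · exact Int.modEq_iff_dvd.2 ⟨-(u * m), by change f.b - B = _; linear_combination -hB⟩
  · exact Int.modEq_iff_dvd.2 ⟨v * m, by change g.b - B = _; linear_combination -hB'⟩

/-- Any two classes contain forms that have a Dirichlet composition. -/
theorem exists_composition [NegDisc D] (f g : Form D) :
    ∃ f' g' h : Form D, f'.Equiv f ∧ g'.Equiv g ∧ IsDirichletComposition f' g' h := by
  obtain ⟨p, r, ⟨s, q, hpr⟩, hc⟩ := g.exists_coprime_value (N := f.a.natAbs)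
    (Int.natAbs_ne_zero.2 f.pos.ne')
  obtain ⟨g', hg', ha, -⟩ := g.exists_subst (p := p) (q := -q) (r := r) (s := s)
    (by linear_combination hpr)
  have : (f.a.natAbs : ℤ) = f.a := Int.natAbs_of_nonneg f.pos.le
  rw [this, ← ha] at hc
  obtain ⟨h, hh⟩ := exists_composition_of_isCoprime f g' hc.symm
  exact ⟨f, g', h, equiv_refl f, hg', hh⟩

/-- The principal form: `(1, 0, -D/4)` if `D ≡ 0 (mod 4)`, and `(1, 1, (1 - D)/4)` if
`D ≡ 1 (mod 4)`. -/
def principal (D : ℤ) [h : NegDisc D] : Form D where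
  a := 1
  b := D % 2
  c := (D % 2 - D) / 4
  disc := by
    rcases h.mod_four with h | h
    · rw [show D % 2 = 0 by omega]; omega
    · rw [show D % 2 = 1 by omega]; omega
  primitive := by simp
  pos := one_pos

/-- The opposite form `(a, -b, c)`. -/
def opposite (f : Form D) : Form D where
  a := f.a
  b := -f.b
  c := f.c
  disc := by have := f.disc; linear_combination this
  primitive := by rw [Int.gcd_neg]; exact f.primitive
  pos := f.pos

theorem Equiv.opposite {f g : Form D} (h : f.Equiv g) : f.opposite.Equiv g.opposite := by
  obtain ⟨p, q, r, s, hd, ha, hb, hc⟩ := (equiv_iff f g).1 h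
  refine (equiv_iff _ _).2 ⟨p, -q, -r, s, by linear_combination hd, ?_, ?_, ?_⟩
  · simp only [Form.opposite, eval] at ha ⊢; linear_combination ha
  · simp only [Form.opposite] at hb ⊢; linear_combination -hb
  · simp only [Form.opposite, eval] at hc ⊢; linear_combination hc

theorem principal_composition [NegDisc D] (f : Form D) :
    IsDirichletComposition (principal D) f f := by
  refine ⟨by simp [principal], by simp [principal], ?_, Int.ModEq.refl _⟩
  have := f.b_emod
  simp only [principal, mul_one]
  rw [Int.ModEq]
  omega

theorem opposite_composition [hD : NegDisc D] (f : Form D) :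
    ∃ f' h : Form D, f'.Equiv f.opposite ∧ h.Equiv (principal D) ∧
      IsDirichletComposition f' f h := by
  have hd := f.disc
  have hc : 0 < f.c := by
    have := hD.neg
    have := f.pos
    by_contra hc
    push Not at hc
    nlinarith [sq_nonneg f.b, mul_nonneg f.pos.le (neg_nonneg.2 hc)]
  have hprim : Int.gcd (Int.gcd f.c f.b) f.a = 1 := by
    have := f.primitive
    rwa [Int.gcd_assoc, Int.gcd_comm, Int.gcd_comm f.b f.c] at this
  obtain ⟨k, hk⟩ : ∃ k, f.b + D % 2 = 2 * k := by
    have := f.b_emod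
    exact ⟨(f.b + D % 2) / 2, by omega⟩
  refine ⟨⟨f.c, f.b, f.a, by linear_combination hd, hprim, hc⟩,
    ⟨f.c * f.a, f.b, 1, by linear_combination hd, by simp, mul_pos hc f.pos⟩, ?_, ?_, ?_⟩
  · refine (equiv_iff _ _).2 ⟨0, -1, 1, 0, by norm_num, ?_, ?_, ?_⟩ <;>
      simp [opposite, eval]
  · have he := (principal D).disc
    have ha : (principal D).a = 1 := rfl
    have hb : (principal D).b = D % 2 := rfl
    refine (equiv_iff _ _).2 ⟨k, 1, -1, 0, by norm_num, ?_, ?_, ?_⟩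
    · apply mul_left_cancel₀ (four_ne_zero (α := ℤ))
      simp only [eval]
      rw [ha, hb] at he ⊢
      linear_combination (-1) * hd + he + (f.b - D % 2 + 2 * k) * hk
    · simp only [ha, hb]
      linear_combination hk
    · simp [eval, ha]
  · refine ⟨?_, rfl, Int.ModEq.refl _, Int.ModEq.refl _⟩
    have : (f.b + f.b) / 2 = f.b := by omega
    simp only [this]
    have := f.primitive
    rwa [Int.gcd_comm f.c f.a, Int.gcd_assoc, Int.gcd_comm f.c f.b, ← Int.gcd_assoc]

end Form

/-- The set `C(D)` of equivalence classes of primitive (positive definite) forms of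
discriminant `D`. -/
def FormClass (D : ℤ) : Type := Quotient (Form.setoid D)

namespace FormClass

variable {D : ℤ}

/-- The class of a form. -/
def mk (f : Form D) : FormClass D := Quotient.mk _ f

theorem mk_eq {f g : Form D} : mk f = mk g ↔ f.Equiv g := Quotient.eq

theorem exists_rep (x : FormClass D) : ∃ f : Form D, mk f = x := Quotient.exists_rep x

/-- `x` is derived from `y`: some form of `x` is derived from some form of `y`. -/
def IsDerived {D' : ℤ} (r : ℤ) (x : FormClass D') (y : FormClass D) : Prop :=
  ∃ (f : Form D') (g : Form D), mk f = x ∧ mk g = y ∧ Form.IsDerived r f g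

variable [NegDisc D]

theorem exists_mul (x y : FormClass D) : ∃ z : FormClass D, ∃ f g h : Form D,
    mk f = x ∧ mk g = y ∧ mk h = z ∧ Form.IsDirichletComposition f g h := by
  obtain ⟨f, rfl⟩ := exists_rep x
  obtain ⟨g, rfl⟩ := exists_rep y
  obtain ⟨f', g', h, hf, hg, H⟩ := Form.exists_composition f g
  exact ⟨mk h, f', g', h, mk_eq.2 hf, mk_eq.2 hg, rfl, H⟩

/-- The product of two classes is the class of any Dirichlet composition of two of their forms
(see `mk_mul_mk` for the independence of choices). -/
noncomputable instance : Mul (FormClass D) := ⟨fun x y => (exists_mul x y).choose⟩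

theorem mk_mul_mk {f g h : Form D} (H : Form.IsDirichletComposition f g h) :
    mk f * mk g = mk h := by
  obtain ⟨f', g', h', hf, hg, hh, H'⟩ := (exists_mul (mk f) (mk g)).choose_spec
  exact hh.symm.trans (mk_eq.2 (H'.equiv H (mk_eq.1 hf) (mk_eq.1 hg)))

instance : One (FormClass D) := ⟨mk (Form.principal D)⟩

instance : Inv (FormClass D) :=
  ⟨Quotient.map Form.opposite fun _ _ h => Form.Equiv.opposite h⟩

theorem lat_of_mul {f g h : Form D} (e : mk f * mk g = mk h) :
    Form.Homothetic (f.lat * g.lat) h.lat := by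
  obtain ⟨f', g', h', hf, hg, hh, H⟩ := (exists_mul (mk f) (mk g)).choose_spec
  have hh' : mk h' = mk h := hh.trans e
  exact (((mk_eq.1 hf).homothetic.mul (mk_eq.1 hg).homothetic).symm.trans H.lat_mul).trans
    (mk_eq.1 hh').homothetic

/-- The class group `C(D)`. -/
noncomputable instance : CommGroup (FormClass D) where
  mul_assoc x y z := by
    obtain ⟨f, rfl⟩ := exists_rep x
    obtain ⟨g, rfl⟩ := exists_rep y
    obtain ⟨h, rfl⟩ := exists_rep z
    obtain ⟨k, hk⟩ := exists_rep (mk f * mk g)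
    obtain ⟨l, hl⟩ := exists_rep (mk g * mk h)
    obtain ⟨m, hm⟩ := exists_rep (mk k * mk h)
    obtain ⟨n, hn⟩ := exists_rep (mk f * mk l)
    rw [← hk, ← hl, ← hm, ← hn, mk_eq]
    apply Form.equiv_of_homothetic
    have h1 := lat_of_mul hk.symm
    have h2 := lat_of_mul hl.symm
    have h3 := lat_of_mul hm.symm
    have h4 := lat_of_mul hn.symm
    refine (((h1.mul (.of_eq rfl)).trans h3).symm.trans (.of_eq (mul_assoc _ _ _))).trans ?_
    exact ((Form.Homothetic.of_eq rfl).mul h2).trans h4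
  mul_comm x y := by
    obtain ⟨f, rfl⟩ := exists_rep x
    obtain ⟨g, rfl⟩ := exists_rep y
    obtain ⟨k, hk⟩ := exists_rep (mk f * mk g)
    obtain ⟨l, hl⟩ := exists_rep (mk g * mk f)
    rw [← hk, ← hl, mk_eq]
    apply Form.equiv_of_homothetic
    exact (lat_of_mul hk.symm).symm.trans ((Form.Homothetic.of_eq (mul_comm _ _)).trans
      (lat_of_mul hl.symm))
  one_mul x := by
    obtain ⟨f, rfl⟩ := exists_rep x
    exact mk_mul_mk f.principal_composition
  mul_one x := by
    obtain ⟨f, rfl⟩ := exists_rep x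
    obtain ⟨k, hk⟩ := exists_rep (mk f * mk (Form.principal D))
    change mk f * mk (Form.principal D) = mk f
    rw [← hk, mk_eq]
    apply Form.equiv_of_homothetic
    exact (lat_of_mul hk.symm).symm.trans ((Form.Homothetic.of_eq (mul_comm _ _)).trans
      f.principal_composition.lat_mul)
  inv_mul_cancel x := by
    obtain ⟨f, rfl⟩ := exists_rep x
    obtain ⟨f', h, hf, hh, H⟩ := f.opposite_composition
    change mk f.opposite * mk f = mk (Form.principal D)
    rw [← mk_eq.2 hf, mk_mul_mk H]
    exact mk_eq.2 hh

/-- Every class contains a form with `|b| ≤ a ≤ c`. -/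
theorem exists_reduced (x : FormClass D) : ∃ f : Form D, mk f = x ∧ |f.b| ≤ f.a ∧ f.a ≤ f.c := by
  obtain ⟨f, hf, hmin⟩ : ∃ f : Form D, mk f = x ∧ ∀ g : Form D, mk g = x → f.a ≤ g.a := by
    obtain ⟨f, hf⟩ := exists_rep x
    obtain ⟨m, ⟨g, hg, hm⟩, hlt⟩ := wellFounded_lt.has_min
      {n : ℕ | ∃ g : Form D, mk g = x ∧ g.a.toNat = n} ⟨_, f, hf, rfl⟩
    refine ⟨g, hg, fun k hk => ?_⟩
    have := hlt k.a.toNat ⟨k, hk, rfl⟩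
    have := k.pos
    have := g.pos
    omega
  have hq : 0 < 2 * f.a := by have := f.pos; omega
  obtain ⟨g, hg, ha, hb⟩ := f.exists_subst (p := 1) (q := -((f.b + f.a) / (2 * f.a))) (r := 0)
    (s := 1) (by ring)
  have hgx : mk g = x := (mk_eq.2 hg).trans hf
  have ha' : g.a = f.a := by rw [ha, Form.eval]; ring
  obtain ⟨k, hk, hka, -⟩ := g.exists_subst (p := 0) (q := -1) (r := 1) (s := 0) (by ring)
  have hkc : k.a = g.c := by rw [hka, Form.eval]; ring
  refine ⟨g, hgx, ?_, ?_⟩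
  · have h1 := Int.emod_nonneg (f.b + f.a) hq.ne'
    have h2 := Int.emod_lt_of_pos (f.b + f.a) hq
    have h3 := Int.emod_add_mul_ediv (f.b + f.a) (2 * f.a)
    have h4 : g.b = (f.b + f.a) % (2 * f.a) - f.a := by
      rw [hb]; linear_combination -h3
    rw [abs_le, ha', h4]
    constructor <;> linarith
  · rw [ha', ← hkc]
    exact hmin k ((mk_eq.2 hk).trans hgx)

/-- The class group is finite. -/
instance : Finite (FormClass D) := by
  choose F hF hb hc using exists_reduced (D := D)
  have key : ∀ x, (F x).a ∈ Set.Icc 0 (-D) ∧ (F x).b ∈ Set.Icc D (-D) := by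
    intro x
    have h1 := (F x).pos
    have h2 := hb x
    have h3 := (F x).disc
    have h5 : (F x).b ^ 2 ≤ (F x).a ^ 2 := sq_le_sq' (by linarith [abs_le.1 h2]) (abs_le.1 h2).2
    have h6 := mul_le_mul_of_nonneg_left (hc x) h1.le
    have h7 : (F x).a ≤ -D := by nlinarith
    rw [abs_le] at h2
    exact ⟨⟨h1.le, h7⟩, by linarith, by linarith⟩
  refine Finite.of_injective
    (fun x => ((⟨_, (key x).1⟩, ⟨_, (key x).2⟩) : Set.Icc 0 (-D) × Set.Icc D (-D))) ?_
  intro x y hxy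
  simp only [Prod.mk.injEq, Subtype.mk.injEq] at hxy
  rw [← hF x, ← hF y]
  congr 1
  refine Form.ext hxy.1 hxy.2 ?_
  have h1 := (F x).disc
  have h2 := (F y).disc
  rw [hxy.1, hxy.2] at h1
  apply mul_left_cancel₀ (mul_ne_zero four_ne_zero (F y).pos.ne')
  linarith

end FormClass

/-- `φ_D(r) = ∏ p^(e - 1) (p - (D/p))`, over the prime powers `p^e` exactly dividing `r`, for odd
`r`. At an odd prime `p` the Kronecker symbol `(D/p)` is the Legendre (Jacobi) symbol. -/
def phi (D : ℤ) (r : ℕ) : ℤ :=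
  ∏ p ∈ r.primeFactors, (p : ℤ) ^ (r.factorization p - 1) * ((p : ℤ) - jacobiSym D p)

end BQF

/-!
Forms of discriminant `D` correspond to lattices in `ℂ` whose ring of multipliers is the order `O`
of discriminant `D`, and composition is multiplication of lattices. Extension of scalars
`L ↦ L O` is a homomorphism `C(D r²) → C(D)`, and it sends the class of `f` to that of `g`
whenever `f` is derived from `g` by a matrix of determinant `r`. So if `a` is the order of `g`,
then `f ^ a` lies in the kernel, whose elements are the classes of the lattices `ℤ v + r O` with
`v ∈ O` prime to `r`. These lattices multiply like the elements `v`, and only the class of `v` in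
`(O/r)ˣ / (ℤ/r)ˣ` matters. That group is killed by `φ_D(r)`: for a prime `p` and
`u = X + Y √D`, Frobenius gives `u ^ p ≡ X + (D/p) Y √D`, hence `u ^ (p - (D/p))` is congruent
modulo `p` to a rational integer; raising to the power `p ^ (e - 1)` lifts this to `p ^ e`, and
the Chinese remainder theorem combines the prime powers dividing `r`. Replacing `v` by `2 v`,
which changes nothing as `r` is odd, puts `v` in the form `X + Y √D`.
-/

namespace BQF

section RationalUnits

variable {R : Type*} [CommRing R]

/-- `u` is congruent modulo `m` to a rational integer prime to `m`: it is trivial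
in `(R/m)ˣ / (ℤ/m)ˣ`. -/
def IsRationalUnitMod (m : ℕ) (u : R) : Prop :=
  ∃ k : ℤ, IsCoprime k m ∧ (m : R) ∣ u - k

namespace IsRationalUnitMod

theorem modulus_one (u : R) : IsRationalUnitMod 1 u :=
  ⟨1, isCoprime_one_left, by simp⟩

theorem pow {m : ℕ} {u : R} (h : IsRationalUnitMod m u) (n : ℕ) :
    IsRationalUnitMod m (u ^ n) := by
  obtain ⟨k, hk, hu⟩ := h
  exact ⟨k ^ n, hk.pow_left, by push_cast; exact hu.trans (sub_dvd_pow_sub_pow _ _ _)⟩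

theorem pow_prime_pow {p : ℕ} {u : R} (h : IsRationalUnitMod p u) (e : ℕ) :
    IsRationalUnitMod (p ^ (e + 1)) (u ^ p ^ e) := by
  obtain ⟨k, hk, hu⟩ := h
  refine ⟨k ^ p ^ e, ?_, ?_⟩
  · push_cast
    exact hk.pow
  · push_cast
    exact dvd_sub_pow_of_dvd_sub hu e

theorem modulus_mul {m n : ℕ} (hmn : IsCoprime (m : ℤ) n) {u : R}
    (hm : IsRationalUnitMod m u) (hn : IsRationalUnitMod n u) :
    IsRationalUnitMod (m * n) u := by
  obtain ⟨k, hk, hku⟩ := hm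
  obtain ⟨l, hl, hlu⟩ := hn
  obtain ⟨α, β, h⟩ := id hmn
  have hR : (α : R) * m + β * n = 1 := by exact_mod_cast congrArg (Int.cast : ℤ → R) h
  have hmnR : IsCoprime (m : R) n := ⟨α, β, hR⟩
  set j : ℤ := l * (α * m) + k * (β * n) with hj
  have hjk : j = k + (l - k) * α * m := by rw [hj]; linear_combination k * h
  have hjl : j = l + (k - l) * β * n := by rw [hj]; linear_combination l * h
  refine ⟨j, ?_, ?_⟩
  · push_cast
    refine IsCoprime.mul_right ?_ ?_
    · rw [hjk]; exact hk.add_mul_right_left _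
    · rw [hjl]; exact hl.add_mul_right_left _
  · push_cast
    refine hmnR.mul_dvd ?_ ?_
    · rw [hjk]
      convert hku.sub (Dvd.intro_left (((l - k) * α : ℤ) : R) rfl) using 1
      push_cast; ring
    · rw [hjl]
      convert hlu.sub (Dvd.intro_left (((k - l) * β : ℤ) : R) rfl) using 1
      push_cast; ring

theorem modulus_prod {ι : Type*} {s : Finset ι} {m : ι → ℕ} {u : R}
    (hs : (s : Set ι).Pairwise (Function.onFun Nat.Coprime m))
    (h : ∀ i ∈ s, IsRationalUnitMod (m i) u) :
    IsRationalUnitMod (∏ i ∈ s, m i) u := by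
  classical
  induction s using Finset.induction_on with
  | empty => exact modulus_one u
  | insert i s hi ih =>
    rw [Finset.prod_insert hi]
    refine modulus_mul (Nat.isCoprime_iff_coprime.2 (Nat.Coprime.prod_right fun j hj => ?_))
      (h i (Finset.mem_insert_self i s))
      (ih (hs.mono (by simp)) fun j hj => h j (Finset.mem_insert_of_mem hj))
    exact hs (by simp) (by simp [hj]) (ne_of_mem_of_not_mem hj hi).symm

theorem of_prime_pow {r : ℕ} (hr : r ≠ 0) {u : R}
    (h : ∀ p ∈ r.primeFactors, IsRationalUnitMod (p ^ r.factorization p) u) :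
    IsRationalUnitMod r u := by
  rw [← Nat.prod_factorization_pow_eq_self hr]
  refine modulus_prod (fun p hp q hq hpq => ?_) h
  exact Nat.coprime_pow_primes _ _ (Nat.prime_of_mem_primeFactors hp)
    (Nat.prime_of_mem_primeFactors hq) hpq

end IsRationalUnitMod

section SquareRoot

variable {D : ℤ} {δ : R}

/-- Frobenius raises `X` and `Y` to themselves, and `δ ^ p = D ^ ((p - 1) / 2) * δ` by Euler's
criterion. -/
theorem dvd_add_mul_sqrt_pow_sub {p : ℕ} [Fact p.Prime] (hp : p ≠ 2) (hδ : δ ^ 2 = D)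
    (X Y : ℤ) : (p : R) ∣ (X + Y * δ) ^ p - (X + jacobiSym D p * Y * δ) := by
  have hpp : p.Prime := Fact.out
  have cast_dvd {x y : ℤ} (h : x ≡ y [ZMOD p]) : (p : R) ∣ x - y := by
    simpa using map_dvd (Int.castRingHom R) h.symm.dvd
  have hX := cast_dvd (Int.ModEq.pow_prime_eq_self hpp X)
  have hY := cast_dvd (Int.ModEq.pow_prime_eq_self hpp Y)
  have hD := cast_dvd (x := D ^ (p / 2)) (y := jacobiSym D p) <| by
    rw [← ZMod.intCast_eq_intCast_iff, ← jacobiSym.legendreSym.to_jacobiSym, legendreSym.eq_pow]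
    push_cast; rfl
  have hδp : δ ^ p = D ^ (p / 2) * δ := by
    obtain ⟨k, hk⟩ := hpp.odd_of_ne_two hp
    rw [← hδ, ← pow_mul, ← pow_succ]
    congr 1
    omega
  obtain ⟨z, hz⟩ := exists_add_pow_prime_eq hpp (X : R) (Y * δ)
  have expand : (X + Y * δ) ^ p - (X + jacobiSym D p * Y * δ) =
      p * (X * (Y * δ) * z) + ((X ^ p : ℤ) - X) + ((Y ^ p : ℤ) - Y) * (D ^ (p / 2) * δ) +
        ((D ^ (p / 2) : ℤ) - jacobiSym D p) * (Y * δ) := by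
    rw [hz, mul_pow, hδp]
    push_cast; ring
  rw [expand]
  exact (((Dvd.intro _ rfl).add hX).add (hY.mul_right _)).add (hD.mul_right _)

theorem isRationalUnitMod_pow_prime_sub_jacobiSym {p : ℕ} [Fact p.Prime] (hp : p ≠ 2)
    (hδ : δ ^ 2 = D) {X Y : ℤ} (hN : IsCoprime (X ^ 2 - D * Y ^ 2) p) {n : ℕ}
    (hn : (n : ℤ) = p - jacobiSym D p) : IsRationalUnitMod p ((X + Y * δ : R) ^ n) := by
  have frob := dvd_add_mul_sqrt_pow_sub hp hδ X Y
  have norm_eq : (X + Y * δ) * (X - Y * δ) = ((X ^ 2 - D * Y ^ 2 : ℤ) : R) := by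
    push_cast
    linear_combination (-(Y : R) ^ 2) * hδ
  rcases jacobiSym.trichotomy D p with hs | hs | hs <;> rw [hs] at hn frob
  · obtain rfl : n = p := by omega
    refine ⟨X, ?_, by simpa using frob⟩
    have hpD : (n : ℤ) ∣ D := by
      rw [← ZMod.intCast_zmod_eq_zero_iff_dvd, ← legendreSym.eq_zero_iff,
        jacobiSym.legendreSym.to_jacobiSym, hs]
    obtain ⟨k, rfl⟩ := hpD
    have sq_eq : X ^ 2 - n * k * Y ^ 2 + n * (k * Y ^ 2) = X ^ 2 := by ring
    exact (IsCoprime.pow_left_iff two_pos).1 (sq_eq ▸ hN.add_mul_left_left (k * Y ^ 2))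
  · obtain ⟨k, rfl⟩ : ∃ k, p = k + 1 := Nat.exists_eq_succ_of_ne_zero (Fact.out : p.Prime).ne_zero
    obtain rfl : n = k := by push_cast at hn; omega
    refine ⟨1, isCoprime_one_left, ?_⟩
    have hNR : IsCoprime ((X ^ 2 - D * Y ^ 2 : ℤ) : R) ((n + 1 : ℕ) : R) := by
      simpa using hN.map (Int.castRingHom R)
    refine hNR.symm.dvd_of_dvd_mul_left ?_
    rw [← norm_eq]
    convert frob.mul_right (X - Y * δ) using 1
    push_cast; ring
  · obtain rfl : n = p + 1 := by omega
    refine ⟨X ^ 2 - D * Y ^ 2, hN, ?_⟩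
    rw [← norm_eq]
    convert frob.mul_right (X + Y * δ) using 1
    push_cast; ring

theorem sub_jacobiSym_nonneg (D : ℤ) {n : ℕ} (hn : 0 < n) : 0 ≤ (n : ℤ) - jacobiSym D n := by
  rcases jacobiSym.trichotomy D n with hs | hs | hs <;> rw [hs] <;> omega

theorem phi_nonneg (D : ℤ) (r : ℕ) : 0 ≤ phi D r :=
  Finset.prod_nonneg fun p hp => mul_nonneg (by positivity)
    (sub_jacobiSym_nonneg D (Nat.pos_of_mem_primeFactors hp))

theorem isRationalUnitMod_pow_phi {r : ℕ} (hr : Odd r) (hδ : δ ^ 2 = D) {X Y : ℤ}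
    (hN : IsCoprime (X ^ 2 - D * Y ^ 2) r) {n : ℕ} (hn : (n : ℤ) = phi D r) :
    IsRationalUnitMod r ((X + Y * δ : R) ^ n) := by
  refine .of_prime_pow hr.pos.ne' fun p hp => ?_
  have hpp := Nat.prime_of_mem_primeFactors hp
  have hpr := Nat.dvd_of_mem_primeFactors hp
  have : Fact p.Prime := ⟨hpp⟩
  have hp2 : p ≠ 2 := by
    rintro rfl
    exact Nat.not_even_iff_odd.2 hr (even_iff_two_dvd.2 hpr)
  obtain ⟨e, he⟩ := Nat.exists_eq_succ_of_ne_zero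
    (hpp.factorization_pos_of_dvd hr.pos.ne' hpr).ne'
  obtain ⟨m, hm⟩ := Int.eq_ofNat_of_zero_le (sub_jacobiSym_nonneg D hpp.pos)
  obtain ⟨k, rfl⟩ : m * p ^ e ∣ n := by
    rw [← Int.natCast_dvd_natCast, hn, phi]
    have := Finset.dvd_prod_of_mem
      (fun q : ℕ => (q : ℤ) ^ (r.factorization q - 1) * ((q : ℤ) - jacobiSym D q)) hp
    simpa [he, ← hm, mul_comm] using this
  rw [he, pow_mul, pow_mul]
  exact ((isRationalUnitMod_pow_prime_sub_jacobiSym hp2 hδ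
    (hN.of_isCoprime_of_dvd_right (by exact_mod_cast hpr)) hm.symm).pow_prime_pow e).pow k

end SquareRoot

end RationalUnits

section LineLattice

variable {R : Type*} [CommRing R] {r : ℕ}

/-- The lattice `ℤ v + r R`. For `v` prime to `r` these multiply like the elements `v`. -/
def lineLattice (r : ℕ) (v : R) : Submodule ℤ R :=
  Submodule.span ℤ {v} ⊔ (Ideal.span {(r : R)}).restrictScalars ℤ

theorem mem_lineLattice {v x : R} :
    x ∈ lineLattice r v ↔ ∃ (k : ℤ) (z : R), k * v + r * z = x := by
  simp [lineLattice, Submodule.mem_sup, Submodule.mem_span_singleton, mul_comm]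

theorem lineLattice_mul {v : R} (hv : IsCoprime v (r : R)) (w : R) :
    lineLattice r v * lineLattice r w = lineLattice r (v * w) := by
  apply le_antisymm
  · rw [Submodule.mul_le]
    intro x hx y hy
    obtain ⟨k, z, rfl⟩ := mem_lineLattice.1 hx
    obtain ⟨l, t, rfl⟩ := mem_lineLattice.1 hy
    exact mem_lineLattice.2 ⟨k * l, k * v * t + z * (l * w) + r * z * t, by push_cast; ring⟩
  · intro x hx
    obtain ⟨k, z, rfl⟩ := mem_lineLattice.1 hx
    obtain ⟨α, β, h⟩ := hv
    have gen_mem (u : R) : u ∈ lineLattice r u := mem_lineLattice.2 ⟨1, 0, by simp⟩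
    have mul_mem (u t : R) : r * t ∈ lineLattice r u := mem_lineLattice.2 ⟨0, t, by simp⟩
    have split : k * (v * w) + r * z =
        k • (v * w) + (v * (r * (α * z)) + r * 1 * (r * (β * z))) := by
      rw [zsmul_eq_mul]
      linear_combination (-(r : R) * z) * h
    rw [split]
    exact add_mem (Submodule.smul_mem _ k (Submodule.mul_mem_mul (gen_mem v) (gen_mem w)))
      (add_mem (Submodule.mul_mem_mul (gen_mem v) (mul_mem w _))
        (Submodule.mul_mem_mul (mul_mem v _) (mul_mem w _)))

theorem lineLattice_eq_of_dvd_sub {u v : R} {k : ℤ} (hk : IsCoprime k r)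
    (h : (r : R) ∣ u - k * v) : lineLattice r u = lineLattice r v := by
  obtain ⟨z, hz⟩ := h
  obtain ⟨α, β, e⟩ := hk
  have eR : (α : R) * k + β * r = 1 := by exact_mod_cast congrArg (Int.cast : ℤ → R) e
  ext x
  simp only [mem_lineLattice]
  constructor <;> rintro ⟨l, t, rfl⟩
  · exact ⟨l * k, l * z + t, by push_cast; linear_combination (-(l : R)) * hz⟩
  · refine ⟨l * α, l * (β * v - α * z) + t, ?_⟩
    push_cast
    linear_combination l * α * hz + l * v * eR

end LineLattice

section Order

open Form (rt rt_sq rt_indep mem_pair)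

/-- The generator `(-ε + √D) / 2` of the quadratic order of discriminant `D`, where
`ε ∈ {0, 1}` has the parity of `D`. -/
noncomputable def omega (D : ℤ) : ℂ := (-((D % 2 : ℤ) : ℂ) + rt D) / 2

theorem omega_sq (D : ℤ) [NegDisc D] :
    omega D ^ 2 = -((D % 2 : ℤ) : ℂ) * omega D - (Form.principal D).c := by
  rw [omega]
  have h := (Form.principal D).cast_disc
  simp only [Form.principal] at h ⊢
  linear_combination (1 / 4 : ℂ) * rt_sq (D := D) - (1 / 4 : ℂ) * h

/-- The quadratic order `ℤ + ℤ (-ε + √D) / 2` of discriminant `D`, as a subring of `ℂ`. -/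
noncomputable def order (D : ℤ) [NegDisc D] : Subalgebra ℤ ℂ :=
  (Submodule.span ℤ {1, omega D}).toSubalgebra (Submodule.subset_span (by simp)) <| by
    intro x y hx hy
    obtain ⟨k, l, rfl⟩ := Submodule.mem_span_pair.1 hx
    obtain ⟨s, t, rfl⟩ := Submodule.mem_span_pair.1 hy
    simp only [zsmul_eq_mul]
    refine mem_pair (k * s - l * t * (Form.principal D).c) (k * t + l * s - l * t * (D % 2)) ?_
    push_cast
    linear_combination (-(l : ℂ) * t) * omega_sq D

variable {D : ℤ} [NegDisc D]

theorem toSubmodule_order : (order D).toSubmodule = Submodule.span ℤ {1, omega D} :=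
  Submodule.toSubalgebra_toSubmodule _ _ _

theorem mem_order {z : ℂ} : z ∈ order D ↔ ∃ m n : ℤ, m + n * omega D = z := by
  rw [← Subalgebra.mem_toSubmodule, toSubmodule_order, Submodule.mem_span_pair]
  simp

theorem order_mul_order :
    (order D).toSubmodule * (order D).toSubmodule = (order D).toSubmodule :=
  (order D).isIdempotentElem_toSubmodule

theorem half_sub_rt_mem_order {b : ℤ} (hb : b % 2 = D % 2) : (-b + rt D) / 2 ∈ order D := by
  refine mem_order.2 ⟨-(b / 2), 1, ?_⟩
  have h : (b : ℂ) = (D % 2 : ℤ) + 2 * (b / 2 : ℤ) := by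
    exact_mod_cast (hb ▸ Int.emod_add_mul_ediv b 2).symm
  rw [omega, h]
  push_cast; ring

theorem rt_mem_order : rt D ∈ order D :=
  mem_order.2 ⟨D % 2, 2, by rw [omega]; push_cast; ring⟩

theorem exists_two_mul_eq {z : ℂ} (hz : z ∈ order D) : ∃ X Y : ℤ, 2 * z = X + Y * rt D := by
  obtain ⟨m, n, rfl⟩ := mem_order.1 hz
  exact ⟨2 * m - n * (D % 2), n, by rw [omega]; push_cast; ring⟩

/-- The norm of `2 v` is prime to `r` because the norm of an inverse of `v` modulo `r` inverts
it up to a power of `2`. -/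
theorem isCoprime_sq_sub_of_isCoprime {r : ℕ} (hr : Odd r) {v : order D}
    (hv : IsCoprime v (r : order D)) {X Y : ℤ} (hXY : (2 * v : ℂ) = X + Y * rt D) :
    IsCoprime (X ^ 2 - D * Y ^ 2) r := by
  obtain ⟨α, β, h⟩ := hv
  obtain ⟨A, B, hα⟩ := exists_two_mul_eq α.2
  obtain ⟨C, E, hβ⟩ := exists_two_mul_eq β.2
  have hC : (α * v + β * r : ℂ) = 1 := by exact_mod_cast congrArg Subtype.val h
  obtain ⟨hrat, hirr⟩ := rt_indep (D := D) (x := A * X + B * Y * D + 2 * r * C)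
    (y := A * Y + B * X + 2 * r * E) (z := 4) (w := 0) <| by
      push_cast
      linear_combination 4 * hC - B * Y * rt_sq (D := D) - (A + B * rt D) * hXY - 2 * v * hα
        - 2 * r * hβ
  have norm_mul : (X ^ 2 - D * Y ^ 2) * (A ^ 2 - D * B ^ 2) =
      2 ^ 4 + r * (4 * C * (r * C - 4) - 4 * D * r * E ^ 2) := by
    linear_combination (A * X + B * Y * D + 4 - 2 * r * C) * hrat
      - D * (A * Y + B * X - 2 * r * E) * hirr
  have two_pow : IsCoprime ((2 : ℤ) ^ 4) r := by
    exact_mod_cast (Nat.isCoprime_iff_coprime.2 hr.coprime_two_left).pow_left (m := 4)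
  exact (norm_mul ▸ two_pow.add_mul_left_left _).of_mul_left_left

theorem rt_mul_sq (D : ℤ) (r : ℕ) : rt (D * (r : ℤ) ^ 2) = r * rt D := by
  have : (-(D * (r : ℤ) ^ 2 : ℤ) : ℝ) = -D * (r : ℝ) ^ 2 := by push_cast; ring
  rw [rt, this, Real.sqrt_mul' _ (sq_nonneg _), Real.sqrt_sq r.cast_nonneg, rt]
  push_cast; ring

variable {r : ℕ}

/-- The lattice `ℤ v + r O` in `ℂ`, for `O` the order of discriminant `D`. Every class in the
kernel of `FormClass.extend` contains such a lattice with `v` prime to `r`. -/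
noncomputable def orderLineLattice (r : ℕ) (v : order D) : Submodule ℤ ℂ :=
  (lineLattice r v).map (order D).val.toLinearMap

theorem orderLineLattice_eq_sup (v : order D) : orderLineLattice r v =
    Submodule.span ℤ {(v : ℂ)} ⊔ Submodule.span ℤ {(r : ℂ)} * (order D).toSubmodule := by
  rw [orderLineLattice, lineLattice, Submodule.map_sup, Submodule.map_span,
    Set.image_singleton]
  congr 1
  ext x
  simp only [Submodule.mem_map, Submodule.restrictScalars_mem, Ideal.mem_span_singleton',
    Submodule.mem_span_singleton_mul]
  constructor
  · rintro ⟨_, ⟨z, rfl⟩, rfl⟩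
    exact ⟨z, z.2, mul_comm _ _⟩
  · rintro ⟨z, hz, rfl⟩
    exact ⟨_, ⟨⟨z, hz⟩, rfl⟩, mul_comm _ _⟩

theorem orderLineLattice_mul {v : order D} (hv : IsCoprime v (r : order D)) (w : order D) :
    orderLineLattice r v * orderLineLattice r w = orderLineLattice r (v * w) := by
  rw [orderLineLattice, orderLineLattice, ← Submodule.map_mul, lineLattice_mul hv,
    orderLineLattice]

theorem mem_orderLineLattice {v : order D} {x : ℂ} :
    x ∈ orderLineLattice r v ↔ ∃ k : ℤ, ∃ z ∈ order D, k * (v : ℂ) + r * z = x := by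
  simp [orderLineLattice_eq_sup, Submodule.mem_sup, Submodule.mem_span_singleton,
    Submodule.mem_span_singleton_mul]

theorem exists_omega_mul_sq (D : ℤ) (r : ℕ) :
    ∃ m : ℤ, omega (D * (r : ℤ) ^ 2) = m + r * omega D := by
  obtain ⟨m, hm⟩ : (2 : ℤ) ∣ r * (D % 2) - D * r ^ 2 % 2 := by
    have : (r * (D % 2) : ℤ) % 2 = D * r ^ 2 % 2 := by
      rcases Int.emod_two_eq_zero_or_one r with h | h <;> simp [Int.mul_emod, pow_two, h]
    omega
  have hmC : (r : ℂ) * (D % 2 : ℤ) - (D * r ^ 2 % 2 : ℤ) = 2 * m := by exact_mod_cast hm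
  refine ⟨m, ?_⟩
  rw [omega, omega, rt_mul_sq]
  linear_combination (1 / 2 : ℂ) * hmC

theorem orderLineLattice_one [NeZero r] : orderLineLattice r (1 : order D) =
    (order (D * (r : ℤ) ^ 2)).toSubmodule := by
  obtain ⟨m, hm⟩ := exists_omega_mul_sq D r
  ext x
  simp only [mem_orderLineLattice, Subalgebra.mem_toSubmodule, mem_order, hm]
  constructor
  · rintro ⟨k, _, ⟨s, t, rfl⟩, rfl⟩
    exact ⟨k + r * s - t * m, t, by push_cast; ring⟩
  · rintro ⟨k, l, rfl⟩
    exact ⟨k + l * m, l * omega D, ⟨0, l, by simp⟩, by push_cast; ring⟩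

end Order

namespace Form

section DiagonalLift

variable {D D' : ℤ} {r : ℕ}

/-- `f(x, y) = g(x, r y)` with leading coefficient prime to `r`: the normal form of a form `f`
derived from `g` by a matrix of determinant `r`. -/
structure IsDiagonalLift (r : ℕ) (f : Form D') (g : Form D) : Prop where
  isCoprime : IsCoprime g.a r
  a_eq : f.a = g.a
  b_eq : f.b = r * g.b
  c_eq : f.c = r ^ 2 * g.c

theorem exists_equiv_isCoprime_a [NegDisc D] (f : Form D) (hr : r ≠ 0) :
    ∃ g : Form D, g.Equiv f ∧ IsCoprime g.a r := by
  obtain ⟨p, q, ⟨s, t, hst⟩, hpq⟩ := f.exists_coprime_value hr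
  obtain ⟨g, hg, ha, -⟩ := f.exists_subst (p := p) (q := -t) (r := q) (s := s)
    (by linear_combination hst)
  exact ⟨g, hg, ha ▸ hpq⟩

theorem exists_equiv_translate [NegDisc D] (f : Form D) (t : ℤ) :
    ∃ g : Form D, g.Equiv f ∧ g.a = f.a ∧ g.b = f.b + 2 * f.a * t := by
  obtain ⟨g, hg, ha, hb⟩ := f.exists_subst (p := 1) (q := t) (r := 0) (s := 1) (by ring)
  exact ⟨g, hg, by rw [ha, eval]; ring, by rw [hb]; ring⟩

theorem primitive_of_dvd (f : Form D') {a b c : ℤ} (ha : a ∣ f.a) (hb : b ∣ f.b)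
    (hc : c ∣ f.c) : Int.gcd (Int.gcd a b) c = 1 := by
  have hgcd : (Int.gcd a b : ℤ) ∣ Int.gcd f.a f.b :=
    Int.dvd_coe_gcd ((Int.gcd_dvd_left a b).trans ha) ((Int.gcd_dvd_right a b).trans hb)
  rw [← Nat.dvd_one, ← f.primitive]
  exact Int.dvd_gcd ((Int.gcd_dvd_left _ c).trans hgcd) ((Int.gcd_dvd_right _ c).trans hc)

theorem exists_isDiagonalLift_of_b_eq (f : Form (D * (r : ℤ) ^ 2)) (hf : IsCoprime f.a r)
    (hr : r ≠ 0) {b : ℤ} (hb : f.b = r * b) (hbD : (4 : ℤ) ∣ b ^ 2 - D) :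
    ∃ g : Form D, IsDiagonalLift r f g := by
  obtain ⟨E, hE⟩ := hbD
  have hr2 : (r : ℤ) ^ 2 ≠ 0 := by positivity
  have hEc : (r : ℤ) ^ 2 * E = f.a * f.c := by
    have hdisc := f.disc
    rw [hb] at hdisc
    apply mul_left_cancel₀ (four_ne_zero (α := ℤ))
    linear_combination hdisc - r ^ 2 * hE
  obtain ⟨c, hc⟩ : (r : ℤ) ^ 2 ∣ f.c :=
    hf.symm.pow_left.dvd_of_dvd_mul_left ⟨E, hEc.symm⟩
  have hEac : E = f.a * c := mul_left_cancel₀ hr2 (by rw [hEc, hc]; ring)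
  refine ⟨⟨f.a, b, c, by rw [hEac] at hE; linear_combination hE, ?_, f.pos⟩, hf, rfl, hb, hc⟩
  exact f.primitive_of_dvd dvd_rfl (hb ▸ dvd_mul_left _ _) (hc ▸ dvd_mul_left _ _)

theorem exists_isDiagonalLift [hD : NegDisc D] [NeZero r] (f : Form (D * (r : ℤ) ^ 2)) :
    ∃ (f' : Form (D * (r : ℤ) ^ 2)) (g : Form D), f'.Equiv f ∧ IsDiagonalLift r f' g := by
  obtain ⟨f₁, hf₁, hcop⟩ := f.exists_equiv_isCoprime_a (NeZero.ne r)
  obtain ⟨u, v, huv⟩ := id hcop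
  obtain ⟨m, hm⟩ : (2 : ℤ) ∣ f₁.b - D * r := by
    have hb := f₁.b_emod
    have hpar : D * (r : ℤ) ^ 2 % 2 = D * r % 2 := by
      rcases Int.emod_two_eq_zero_or_one r with h | h <;> simp [Int.mul_emod, pow_two, h]
    omega
  obtain ⟨f', hf', ha, hb⟩ := f₁.exists_equiv_translate (-u * m)
  have hb' : f'.b = r * (D + 2 * v * m) := by
    rw [hb]; linear_combination hm - 2 * m * huv
  have hbD : (4 : ℤ) ∣ (D + 2 * v * m) ^ 2 - D := by
    obtain ⟨k, hk⟩ : (4 : ℤ) ∣ D ^ 2 - D := by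
      rw [show D ^ 2 - D = D * (D - 1) by ring]
      rcases hD.mod_four with h | h
      · exact (Int.dvd_of_emod_eq_zero h).mul_right _
      · exact (Int.dvd_self_sub_of_emod_eq h).mul_left _
    exact ⟨k + D * v * m + v ^ 2 * m ^ 2, by linear_combination hk⟩
  obtain ⟨g, hg⟩ := f'.exists_isDiagonalLift_of_b_eq (ha ▸ hcop) (NeZero.ne r) hb' hbD
  exact ⟨f', g, equiv_trans hf' hf₁, hg⟩

theorem IsDerived.equiv_left {r : ℤ} {f f' : Form D'} {g : Form D} (h : IsDerived r f g)
    (e : f'.Equiv f) : IsDerived r f' g := by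
  obtain ⟨A, hd, hA⟩ := h
  obtain ⟨B, hB⟩ := e
  refine ⟨A * B, by rw [Matrix.det_mul, hd, B.det_coe, mul_one], fun x y => ?_⟩
  rw [hB, hA]
  simp only [Matrix.mul_apply, Fin.sum_univ_two]
  congr 1 <;> ring

theorem IsDerived.exists_coeffs {r : ℤ} {f : Form D'} {g : Form D} (h : IsDerived r f g) :
    ∃ x y z w : ℤ, x * w - y * z = r ∧ f.a = g.eval x z ∧
      f.b = 2 * g.a * x * y + g.b * (x * w + y * z) + 2 * g.c * z * w ∧ f.c = g.eval y w := by
  obtain ⟨A, hd, hA⟩ := h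
  refine ⟨A 0 0, A 0 1, A 1 0, A 1 1, by rwa [Matrix.det_fin_two] at hd, ?_, ?_, ?_⟩
  · simpa [eval] using hA 1 0
  · have hxy := hA 1 1
    have hx := hA 1 0
    have hy := hA 0 1
    simp only [eval] at hxy hx hy
    linear_combination hxy - hx - hy
  · simpa [eval] using hA 0 1

/-- As `g'.a` is prime to `r`, the second column of a matrix deriving `f` from `g` is divisible
by `r`; dividing it by `r` gives a matrix of determinant `1` taking `g` to `g'`. -/
theorem IsDiagonalLift.equiv_of_isDerived {f : Form D'} {g g' : Form D} [NeZero r]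
    (h : IsDiagonalLift r f g') (hfg : IsDerived r f g) : g'.Equiv g := by
  obtain ⟨x, y, z, w, hdet, ha, hb, hc⟩ := hfg.exists_coeffs
  rw [h.a_eq] at ha
  rw [h.b_eq] at hb
  rw [h.c_eq] at hc
  obtain ⟨k, hk⟩ : (2 : ℤ) ∣ g'.b - g.b := by
    have := g.b_emod
    have := g'.b_emod
    omega
  have hrk : r * k = g.a * x * y + g.b * y * z + g.c * z * w := by
    apply mul_left_cancel₀ (two_ne_zero (α := ℤ))
    linear_combination hb + g.b * hdet - r * hk
  rw [eval] at ha
  obtain ⟨y, rfl⟩ : (r : ℤ) ∣ y := h.isCoprime.symm.dvd_of_dvd_mul_left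
    ⟨k * x - g.c * z, by linear_combination y * ha - x * hrk - g.c * z * hdet⟩
  obtain ⟨w, rfl⟩ : (r : ℤ) ∣ w := h.isCoprime.symm.dvd_of_dvd_mul_left
    ⟨k * z + g.b * z + g.a * x,
      by linear_combination w * ha - z * hrk + (g.b * z + g.a * x) * hdet⟩
  have hr : (r : ℤ) ≠ 0 := by exact_mod_cast NeZero.ne r
  refine (equiv_iff _ _).2 ⟨x, y, z, w, mul_left_cancel₀ hr ?_, ha, mul_left_cancel₀ hr ?_,
    mul_left_cancel₀ (pow_ne_zero 2 hr) ?_⟩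
  · linear_combination hdet
  · linear_combination hb
  · rw [hc, eval, eval]; ring

theorem IsDiagonalLift.lat_eq_sup {f : Form (D * (r : ℤ) ^ 2)} {g : Form D}
    (h : IsDiagonalLift r f g) :
    f.lat = Submodule.span ℤ {(2 * g.a : ℂ)} ⊔ Submodule.span ℤ {(r : ℂ)} * g.lat := by
  have hgen : (-f.b + rt (D * (r : ℤ) ^ 2) : ℂ) = r * (-g.b + rt D) := by
    rw [h.b_eq, rt_mul_sq]
    push_cast; ring
  rw [lat, lat, mul_span_pair, h.a_eq, hgen, Submodule.span_insert, Submodule.span_insert,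
    ← sup_assoc]
  congr 1
  refine (sup_eq_left.2 ?_).symm
  rw [Submodule.span_singleton_le_iff_mem, Submodule.mem_span_singleton]
  exact ⟨r, by simp⟩

end DiagonalLift

section Lattice

variable {D D' : ℤ} [NegDisc D]

theorem exists_eq_two_mul_of_mem_lat (g : Form D) {x : ℂ} (hx : x ∈ g.lat) :
    ∃ z ∈ order D, x = 2 * z := by
  obtain ⟨k, l, rfl⟩ := Submodule.mem_span_pair.1 hx
  refine ⟨k • (g.a : ℂ) + l • ((-g.b + rt D) / 2), ?_, ?_⟩
  · exact add_mem (zsmul_mem (intCast_mem _ _) _)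
      (zsmul_mem (half_sub_rt_mem_order g.b_emod) _)
  · simp only [zsmul_eq_mul]; ring

theorem lat_mul_order (g : Form D) : g.lat * (order D).toSubmodule = g.lat := by
  refine le_antisymm ?_ fun x hx => by
    simpa only [mul_one] using
      Submodule.mul_mem_mul hx ((order D).mem_toSubmodule.2 (one_mem _))
  rw [toSubmodule_order, lat, Submodule.span_mul_span, Submodule.span_le]
  obtain ⟨k, hk⟩ : (2 : ℤ) ∣ g.b - D % 2 := by
    have := g.b_emod
    omega
  have hkC : (g.b : ℂ) - (D % 2 : ℤ) = 2 * k := by exact_mod_cast hk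
  have homega : omega D = k + (-g.b + rt D) / 2 := by
    rw [omega]; linear_combination (1 / 2 : ℂ) * hkC
  rintro _ ⟨s, rfl | rfl, t, rfl | rfl, rfl⟩
  · exact mem_pair 1 0 (by push_cast; ring)
  · exact mem_pair k g.a (by rw [homega]; push_cast; ring)
  · exact mem_pair 0 1 (by push_cast; ring)
  · refine mem_pair (-g.c) (k - g.b) ?_
    rw [homega]
    push_cast
    linear_combination (1 / 2 : ℂ) * g.cast_disc - (1 / 2 : ℂ) * rt_sq (D := D)

theorem lat_principal : (principal D).lat =
    Submodule.span ℤ {2} * (order D).toSubmodule := by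
  rw [toSubmodule_order, mul_span_pair, lat, omega]
  congr 2
  · simp [principal]
  · simp [principal]; ring

variable {r : ℕ}

theorem IsDiagonalLift.exists_eq_of_mem_lat {f : Form D'} {g : Form D}
    (h : IsDiagonalLift r f g) {x : ℂ} (hx : x ∈ g.lat) :
    ∃ y ∈ order D, ∃ z ∈ g.lat, x = 2 * g.a * y + r * z := by
  obtain ⟨y, hy, rfl⟩ := g.exists_eq_two_mul_of_mem_lat hx
  obtain ⟨u, v, huv⟩ := h.isCoprime
  have huvC : (u * g.a + v * r : ℂ) = 1 := by exact_mod_cast huv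
  refine ⟨u • y, zsmul_mem hy u, v • (2 * y), zsmul_mem hx v, ?_⟩
  simp only [zsmul_eq_mul]
  linear_combination (-2 * y) * huvC

theorem IsDiagonalLift.lat_mul_order {f : Form (D * (r : ℤ) ^ 2)} {g : Form D}
    (h : IsDiagonalLift r f g) : f.lat * (order D).toSubmodule = g.lat := by
  rw [h.lat_eq_sup, Submodule.sup_mul, mul_assoc, g.lat_mul_order]
  apply le_antisymm
  · have two_a_mem : (2 * g.a : ℂ) ∈ g.lat := mem_pair 1 0 (by push_cast; ring)
    refine sup_le ?_ (Submodule.mul_le.2 ?_)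
    · calc Submodule.span ℤ {(2 * g.a : ℂ)} * (order D).toSubmodule
          ≤ g.lat * (order D).toSubmodule := by
            gcongr
            rwa [Submodule.span_singleton_le_iff_mem]
        _ = g.lat := g.lat_mul_order
    · intro x hx y hy
      obtain ⟨k, rfl⟩ := Submodule.mem_span_singleton.1 hx
      simpa [mul_assoc] using Submodule.smul_mem _ (k * r) hy
  · intro x hx
    obtain ⟨y, hy, z, hz, rfl⟩ := h.exists_eq_of_mem_lat hx
    exact Submodule.add_mem_sup
      (Submodule.mul_mem_mul (Submodule.mem_span_singleton_self _) hy)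
      (Submodule.mul_mem_mul (Submodule.mem_span_singleton_self _) hz)

end Lattice

end Form

namespace FormClass

open Form (Homothetic IsDiagonalLift mem_pair rt rt_sq)

variable {D : ℤ} [NegDisc D]

/-- The lattice `L ⊂ ℂ` belongs to the class `x`: it is homothetic to the lattice of a form
of `x`. -/
def HasLattice (x : FormClass D) (L : Submodule ℤ ℂ) : Prop :=
  ∃ f : Form D, mk f = x ∧ Homothetic f.lat L

theorem hasLattice_mk_iff {f : Form D} {L : Submodule ℤ ℂ} :
    HasLattice (mk f) L ↔ Homothetic f.lat L := by
  refine ⟨?_, fun h => ⟨f, rfl, h⟩⟩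
  rintro ⟨f', hf', h⟩
  exact (mk_eq.1 hf').homothetic.symm.trans h

theorem hasLattice_lat (f : Form D) : HasLattice (mk f) f.lat :=
  hasLattice_mk_iff.2 (.of_eq rfl)

theorem hasLattice_one : HasLattice (1 : FormClass D) (order D).toSubmodule :=
  hasLattice_mk_iff.2 ⟨1, 2, one_ne_zero, two_ne_zero, by
    rw [← Submodule.one_eq_span, one_mul]; exact Form.lat_principal⟩

namespace HasLattice

variable {x y : FormClass D} {L M : Submodule ℤ ℂ}

theorem homothetic (hx : HasLattice x L) (hy : HasLattice x M) : Homothetic L M := by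
  obtain ⟨f, rfl, h⟩ := hx
  exact h.symm.trans (hasLattice_mk_iff.1 hy)

theorem eq (hx : HasLattice x L) (hy : HasLattice y L) : x = y := by
  obtain ⟨f, rfl, hf⟩ := hx
  obtain ⟨g, rfl, hg⟩ := hy
  exact mk_eq.2 (Form.equiv_of_homothetic (hf.trans hg.symm))

theorem mul (hx : HasLattice x L) (hy : HasLattice y M) : HasLattice (x * y) (L * M) := by
  obtain ⟨f, rfl, hf⟩ := hx
  obtain ⟨g, rfl, hg⟩ := hy
  obtain ⟨h, hh⟩ := exists_rep (mk f * mk g)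
  exact ⟨h, hh, (lat_of_mul hh.symm).symm.trans (hf.mul hg)⟩

end HasLattice

variable {r : ℕ} [NeZero r]

theorem exists_isDiagonalLift (x : FormClass (D * (r : ℤ) ^ 2)) :
    ∃ (f : Form (D * (r : ℤ) ^ 2)) (g : Form D), mk f = x ∧ IsDiagonalLift r f g := by
  obtain ⟨f, rfl⟩ := exists_rep x
  obtain ⟨f', g, hf', h⟩ := f.exists_isDiagonalLift
  exact ⟨f', g, mk_eq.2 hf', h⟩

theorem exists_extension (x : FormClass (D * (r : ℤ) ^ 2)) :
    ∃ y : FormClass D, ∀ L, HasLattice x L → HasLattice y (L * (order D).toSubmodule) := by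
  obtain ⟨f, g, rfl, h⟩ := exists_isDiagonalLift x
  refine ⟨mk g, fun L hL => hasLattice_mk_iff.2 ?_⟩
  rw [← h.lat_mul_order]
  exact (hasLattice_mk_iff.1 hL).mul (.of_eq rfl)

/-- Extension of scalars `C(D r²) → C(D)`, which sends the class of a lattice `L` to that of
`L O`, for `O` the order of discriminant `D`. -/
noncomputable def extend (D : ℤ) [NegDisc D] (r : ℕ) [NeZero r] :
    FormClass (D * (r : ℤ) ^ 2) →* FormClass D :=
  MonoidHom.mk' (fun x => (exists_extension x).choose) fun x y => by
    obtain ⟨f, hf⟩ := exists_rep x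
    obtain ⟨g, hg⟩ := exists_rep y
    have hx := hf ▸ hasLattice_lat f
    have hy := hg ▸ hasLattice_lat g
    have hmul := ((exists_extension x).choose_spec _ hx).mul
      ((exists_extension y).choose_spec _ hy)
    rw [mul_mul_mul_comm, order_mul_order] at hmul
    exact ((exists_extension (x * y)).choose_spec _ (hx.mul hy)).eq hmul

theorem HasLattice.extend {x : FormClass (D * (r : ℤ) ^ 2)} {L : Submodule ℤ ℂ}
    (h : HasLattice x L) : HasLattice (extend D r x) (L * (order D).toSubmodule) :=
  (exists_extension x).choose_spec L h

theorem extend_mk_of_isDiagonalLift {f : Form (D * (r : ℤ) ^ 2)} {g : Form D}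
    (h : IsDiagonalLift r f g) : extend D r (mk f) = mk g :=
  (h.lat_mul_order ▸ (hasLattice_lat f).extend).eq (hasLattice_lat g)

theorem extend_of_isDerived {x : FormClass (D * (r : ℤ) ^ 2)} {y : FormClass D}
    (h : IsDerived (r : ℤ) x y) : extend D r x = y := by
  obtain ⟨f, g, rfl, rfl, hfg⟩ := h
  obtain ⟨f', g', hf', hlift⟩ := exists_isDiagonalLift (mk f)
  rw [← hf', extend_mk_of_isDiagonalLift hlift, mk_eq]
  exact hlift.equiv_of_isDerived (hfg.equiv_left (mk_eq.1 hf'))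

theorem exists_hasLattice_of_extend_eq_one {x : FormClass (D * (r : ℤ) ^ 2)}
    (hx : extend D r x = 1) :
    ∃ v : order D, IsCoprime v (r : order D) ∧ HasLattice x (orderLineLattice r v) := by
  obtain ⟨f, g, rfl, h⟩ := exists_isDiagonalLift x
  rw [extend_mk_of_isDiagonalLift h] at hx
  obtain ⟨u, w, hu, hw, huw⟩ := hasLattice_mk_iff.1 (hx ▸ hasLattice_one)
  have exists_mul_eq {z : ℂ} (hz : z ∈ g.lat) : ∃ v : order D, w * v = u * z := by
    have := Submodule.mul_mem_mul (Submodule.mem_span_singleton_self u) hz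
    rw [huw, Submodule.mem_span_singleton_mul] at this
    obtain ⟨v, hv, e⟩ := this
    exact ⟨⟨v, hv⟩, e⟩
  obtain ⟨v, hv⟩ := exists_mul_eq (z := 2 * g.a) (mem_pair 1 0 (by push_cast; ring))
  refine ⟨v, ?_, hasLattice_mk_iff.2 ⟨u, w, hu, hw, ?_⟩⟩
  · obtain ⟨z, hz, huz⟩ : ∃ z ∈ g.lat, u * z = w := by
      rw [← Submodule.mem_span_singleton_mul, huw, Submodule.mem_span_singleton_mul]
      exact ⟨1, one_mem (order D), mul_one w⟩
    obtain ⟨y, hy, z', hz', rfl⟩ := h.exists_eq_of_mem_lat hz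
    obtain ⟨β, hβ⟩ := exists_mul_eq hz'
    refine ⟨⟨y, hy⟩, β, Subtype.ext (mul_left_cancel₀ hw ?_)⟩
    push_cast
    linear_combination huz + y * hv + r * hβ
  · rw [h.lat_eq_sup, orderLineLattice_eq_sup, Submodule.mul_sup, Submodule.mul_sup,
      mul_left_comm, huw, mul_left_comm, Submodule.span_mul_span, Submodule.span_mul_span,
      Set.singleton_mul_singleton, Set.singleton_mul_singleton, hv]

theorem HasLattice.pow {x : FormClass (D * (r : ℤ) ^ 2)} {v : order D}
    (hv : IsCoprime v (r : order D)) (h : HasLattice x (orderLineLattice r v)) (n : ℕ) :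
    HasLattice (x ^ n) (orderLineLattice r (v ^ n)) := by
  induction n with
  | zero => simpa only [pow_zero, orderLineLattice_one] using hasLattice_one
  | succ n ih => simpa only [pow_succ', orderLineLattice_mul hv] using h.mul ih

theorem pow_phi_eq_one_of_extend_eq_one (hr : Odd r) {x : FormClass (D * (r : ℤ) ^ 2)}
    (hx : extend D r x = 1) {n : ℕ} (hn : (n : ℤ) = phi D r) : x ^ n = 1 := by
  obtain ⟨v, hv, h⟩ := exists_hasLattice_of_extend_eq_one hx
  obtain ⟨X, Y, hXY⟩ := exists_two_mul_eq v.2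
  let δ : order D := ⟨rt D, rt_mem_order⟩
  have two_mul_v : 2 * v = X + Y * δ := Subtype.ext hXY
  obtain ⟨k, hk, hvk⟩ := isRationalUnitMod_pow_phi (δ := δ) hr (Subtype.ext rt_sq)
    (isCoprime_sq_sub_of_isCoprime hr hv hXY) hn
  have two_pow : IsCoprime ((2 : ℤ) ^ n) r := by
    exact_mod_cast (Nat.isCoprime_iff_coprime.2 hr.coprime_two_left).pow_left (m := n)
  have lattice_eq : lineLattice r (v ^ n) = lineLattice r 1 :=
    calc lineLattice r (v ^ n) = lineLattice r ((2 * v) ^ n) :=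
          (lineLattice_eq_of_dvd_sub two_pow (by simp [mul_pow])).symm
      _ = lineLattice r 1 := lineLattice_eq_of_dvd_sub hk (by simpa [two_mul_v] using hvk)
  refine (h.pow hv n).eq ?_
  rw [orderLineLattice, lattice_eq, ← orderLineLattice, orderLineLattice_one]
  exact hasLattice_one

end FormClass

end BQF

theorem mainTheorem6 (D : ℤ) [BQF.NegDisc D] (r : ℕ) [NeZero r] (hr : Odd r)
    (f : BQF.FormClass (D * (r : ℤ) ^ 2)) (g : BQF.FormClass D)
    (hfg : BQF.FormClass.IsDerived (r : ℤ) f g) :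
    (orderOf f : ℤ) ∣ (orderOf g : ℤ) * BQF.phi D r := by
  obtain ⟨n, hn⟩ := Int.eq_ofNat_of_zero_le (BQF.phi_nonneg D r)
  have hker : BQF.FormClass.extend D r (f ^ orderOf g) = 1 := by
    rw [map_pow, BQF.FormClass.extend_of_isDerived hfg, pow_orderOf_eq_one]
  have hpow : f ^ (orderOf g * n) = 1 := by
    rw [pow_mul]
    exact BQF.FormClass.pow_phi_eq_one_of_extend_eq_one hr hker hn.symm
  rw [hn]
  exact_mod_cast orderOf_dvd_of_pow_eq_one hpow
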